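/- Let $d\ge 1$, $\sigma\in\mathbb N$, $\epsilon\in\{1,-1\}$, $T>0$, $s>d/2$, $\alpha>0$, $\beta\ge 0$, and write $\langle\xi\rangle=(1+|\xi|^2)^{1/2}$. For $h\in(0,1]$ let $P_h:\mathbb R^d\to\mathbb R$ be measurable with $$|P_h(\xi)+|\xi|^2|\le C_0\,h^\alpha\langle\xi\rangle^\beta\qquad\text{for all }\xi\in\mathbb R^d,\ h\in(0,1],$$ where $C_0$ does not depend on $h$ and $\xi$, and let $P_h(D)$ be the Fourier multiplier with symbol $P_h$. Let $u\in C([0,T];L^2(\mathbb R^d))$ be a solution on $[0,T]$ (in the sense of Duhamel's formula in $L^2$) of the nonlinear Schrödinger equation $$i\partial_t u+\Delta u=\epsilon|u|^{2\sigma}u ,$$ and suppose that $u\in L^\infty([0,T];H^{s+\beta}(\mathbb R^d))$. For a family of functions $f_h$, let $u^h\in C([0,T];L^2(\mathbb R^d))$ denote the solution on $[0,T]$ (in the same sense) of the saturated equation $$i\partial_t u^h+P_h(D)u^h=\epsilon\,\big(f_h(|u^h|^2)\big)^{\sigma}u^h,\qquad u^h|_{t=0}=u|_{t=0}.$$ 1.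 If $f_h(y)=\frac1h f(hy)$, where $f\in C^\infty(\mathbb R;\mathbb R)$ satisfies $f(y)=y$ for $0\le y\le 1$ and $f(y)=2$ for $y\ge 2$, then there are $C$ and $h_0\in(0,1]$ such that $\|u-u^h\|_{L^\infty([0,T];H^s)}\le C h^{\alpha}$ for all $h\in(0,h_0]$. 2. If $f_h(y)=\dfrac{y}{1+hy}$, then there are $C$ and $h_0\in(0,1]$ such that $\|u-u^h\|_{L^\infty([0,T];H^s)}\le C h^{\min(\alpha,1)}$ for all $h\in(0,h_0]$. -/

import Mathlib

open MeasureTheory Set FourierTransform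
open scoped ENNReal ContDiff

noncomputable section

/-- The space `ℝ^d` with its Euclidean norm. -/
abbrev Space (d : ℕ) : Type := EuclideanSpace ℝ (Fin d)

/-- The space `L²(ℝ^d; ℂ)`. -/
abbrev L2 (d : ℕ) : Type := Lp ℂ 2 (volume : Measure (Space d))

/-- The Fourier multiplier `m(D)` on `L²`, in the normalisation
`f̂(ξ) = (2π)^{-d/2} ∫ e^{-ix·ξ} f(x) dx`, that is `(m(D) f)^(ξ) = m(ξ) f̂(ξ)`.
Since Mathlib's Fourier transform satisfies `𝓕 f η = (2π)^{d/2} f̂(2πη)`, the frequency variable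
is rescaled by `2π`. The value is `0` if `m f̂` is not in `L²`, which never happens for bounded
measurable `m`. -/
def fourierMul {d : ℕ} (m : Space d → ℂ) (f : L2 d) : L2 d :=
  open scoped Classical in
  if hm : MemLp (fun η : Space d => m ((2 * Real.pi) • η) * (𝓕 f : L2 d) η) 2 volume then
    𝓕⁻ (hm.toLp _ : L2 d)
  else 0

/-- The unitary group `S(t) = e^{itP(D)}` of the equation `i ∂ₜ v + P(D) v = 0`. -/
def propagator {d : ℕ} (P : Space d → ℝ) (t : ℝ) : L2 d → L2 d :=
  fourierMul fun ξ => Complex.exp (Complex.I * (t * P ξ : ℝ))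

/-- `u ∈ C([0,T]; L²)` is a (mild, that is Duhamel) solution on `[0,T]` of
`i ∂ₜ u + P(D) u = ε (g(|u|²))^σ u`, with initial datum `u 0`:
the nonlinearity `N(t) = (g(|u(t)|²))^σ u(t)` belongs to `L¹([0,T]; L²)` and
`u(t) = S(t) u(0) - i ε ∫₀ᵗ S(t-τ) N(τ) dτ` for all `t ∈ [0,T]`. -/
structure IsMildSolution {d : ℕ} (P : Space d → ℝ) (ε : ℝ) (g : ℝ → ℝ) (σ : ℕ) (T : ℝ)
    (u : ℝ → L2 d) : Prop where
  continuousOn : ContinuousOn u (Icc 0 T)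
  duhamel : ∃ N : ℝ → L2 d,
    (∀ᵐ t ∂(volume.restrict (Icc 0 T)),
      (N t : Space d → ℂ) =ᵐ[volume] fun x => (((g (‖u t x‖ ^ 2)) ^ σ : ℝ) : ℂ) * u t x) ∧
    IntegrableOn N (Icc 0 T) volume ∧
    ∀ t ∈ Icc 0 T,
      u t = propagator P t (u 0) -
        (Complex.I * (ε : ℂ)) • ∫ τ in (0 : ℝ)..t, propagator P (t - τ) (N τ)

/-- The symbol `-|ξ|²` of the Laplacian. -/
def laplaceSymbol {d : ℕ} (ξ : Space d) : ℝ := -‖ξ‖ ^ 2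

/-- The `H^s` norm `(∫ ⟨ξ⟩^{2s} |f̂(ξ)|² dξ)^{1/2}`, `⟨ξ⟩ = (1 + |ξ|²)^{1/2}`, of `f ∈ L²`, possibly
infinite (the substitution `ξ = 2πη` leads to Mathlib's normalisation of the Fourier transform). -/
def sobolevNorm {d : ℕ} (s : ℝ) (f : L2 d) : ℝ≥0∞ :=
  (∫⁻ η : Space d,
    ENNReal.ofReal ((1 + ‖(2 * Real.pi) • η‖ ^ 2) ^ s) * ‖(𝓕 f : L2 d) η‖ₑ ^ 2) ^ (1 / 2 : ℝ)

/-- The norm of `L^∞([0,T]; H^s)`, possibly infinite. -/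
def linftySobolevNorm {d : ℕ} (T s : ℝ) (u : ℝ → L2 d) : ℝ≥0∞ :=
  essSup (fun t => sobolevNorm s (u t)) (volume.restrict (Icc 0 T))

/-- A smooth profile `f : ℝ → ℝ` equal to the identity on `[0,1]` and to `2` on `[2,∞)`. -/
structure IsSaturationProfile (f : ℝ → ℝ) : Prop where
  smooth : ContDiff ℝ ∞ f
  eq_self : ∀ y ∈ Icc (0 : ℝ) 1, f y = y
  eq_two : ∀ y : ℝ, 2 ≤ y → f y = 2

/-- The saturation `f_h(y) = f(h y) / h` of a profile `f`. -/
def profileSaturation (f : ℝ → ℝ) (h y : ℝ) : ℝ := 1 / h * f (h * y)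

/-- The saturation `f_h(y) = y / (1 + h y)`. -/
def rationalSaturation (h y : ℝ) : ℝ := y / (1 + h * y)

end

/-! For a fixed `h` the saturated nonlinearity is a globally Lipschitz map of `L²`, because the
saturation is bounded and stops growing at large amplitude. The Lipschitz constant blows up with
`1/h`, so it gives no rate. It does show that the Picard iterates of the saturated Duhamel equation
converge in `L²` to `u^h`, whatever continuous function they start from. Here they start from `u`
itself.

The rate comes from `H^s`. Since `s > d/2`, this space is an algebra embedded in `L^∞`, and on a
bounded set of `H^s` the saturated nonlinearity differs from the exact one by `O(h^γ)`, with
constants independent of `h`. By Duhamel's formula and `|e^{ia} - e^{ib}| ≤ |a - b|`, an induction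
shows that every iterate satisfies `‖u_n(t) - u(t)‖_{H^s} ≤ M h^γ e^{Kt}`
(`sobolevNorm_picardIterate_sub_le`). The loss of `β` derivatives falls only on `u(0)` and on the
nonlinearity of `u`, both bounded in `H^{s+β}`. The `H^s` norm is lower semicontinuous under `L²`
convergence, so the bound passes to `u^h`. No `H^s` regularity of `u^h` has to be known beforehand,
and no continuation argument is needed.

What depends on the saturation is consistency on bounded sets of `H^s` (`IsConsistentSaturation`).
For a profile the error vanishes once `h |v|² ≤ 1`, so the symbol alone limits the rate. For
`y/(1+hy)` the error is `-h y²/(1+hy)`, of order `h`, whence `min(α, 1)`. -/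

open scoped NNReal

/-! ### Fourier inversion on `L²` and bounded multipliers -/

/-- The `L²` inverse Fourier transform of an integrable `L²` function is given by the integral. -/
theorem coeFn_fourierInv_toLp {d : ℕ} {H : Space d → ℂ} (h1 : Integrable H)
    (h2 : MemLp H 2 volume) : ((𝓕⁻ (h2.toLp H : L2 d) : L2 d) : Space d → ℂ) =ᵐ[volume] 𝓕⁻ H := by
  have hc : Continuous (𝓕⁻ H) := by
    have := VectorFourier.fourierIntegral_continuous (μ := (volume : Measure (Space d)))
      (L := -innerₗ (Space d)) Real.continuous_fourierChar
      (by
        simp only [LinearMap.neg_apply, innerₗ_apply_apply]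
        exact (continuous_inner (𝕜 := ℝ) (E := Space d)).neg) h1
    exact this
  refine ae_eq_of_integral_contDiff_smul_eq
    ((Lp.memLp (𝓕⁻ (h2.toLp H : L2 d) : L2 d)).locallyIntegrable (by norm_num))
    hc.locallyIntegrable fun g g_smooth g_cpt => ?_
  have hg₁ : HasCompactSupport (Complex.ofRealCLM ∘ g) := g_cpt.comp_left rfl
  have hg₂ : ContDiff ℝ ∞ (Complex.ofRealCLM ∘ g) := by fun_prop
  set G := hg₁.toSchwartzMap hg₂ with hG
  have hGa : ∀ x, G x = (g x : ℂ) := fun x => rfl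
  have e1 := congrArg (fun D => D G) (Lp.fourierInv_toTemperedDistribution_eq (h2.toLp H : L2 d))
  simp only [TemperedDistribution.fourierInv_apply, Lp.toTemperedDistribution_apply] at e1
  have e2 : ∫ x, (𝓕⁻ G) x • (h2.toLp H : L2 d) x = ∫ x, (𝓕⁻ (G : Space d → ℂ)) x • H x := by
    refine integral_congr_ae ?_
    filter_upwards [h2.coeFn_toLp] with x hx
    rw [hx, SchwartzMap.fourierInv_coe]
  have e3 : ∫ x, (𝓕⁻ (G : Space d → ℂ)) x • H x = ∫ x, G x • (𝓕⁻ H) x := by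
    have := VectorFourier.integral_fourierIntegral_smul_eq_flip
      (μ := (volume : Measure (Space d))) (ν := (volume : Measure (Space d)))
      (L := -innerₗ (Space d)) (f := (G : Space d → ℂ)) (g := H) Real.continuous_fourierChar
      (by
        simp only [LinearMap.neg_apply, innerₗ_apply_apply]
        exact (continuous_inner (𝕜 := ℝ) (E := Space d)).neg) G.integrable h1
    -- The pairing is symmetric, so the flipped transform is again the inverse Fourier transform.
    have hf : (-innerₗ (Space d)).flip = -innerₗ (Space d) := by
      ext x y; simp [real_inner_comm]
    rw [hf] at this
    exact this
  rw [e2, e3] at e1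
  simpa [hGa, Complex.real_smul] using e1.symm

/-- The inverse Fourier transform of a convolution is a product. -/
theorem fourierInv_convolution {d : ℕ} {F G : Space d → ℂ} (hF : Integrable F)
    (hG : Integrable G) (x : Space d) :
    𝓕⁻ (convolution F G (ContinuousLinearMap.mul ℂ ℂ) volume) x = 𝓕⁻ F x * 𝓕⁻ G x := by
  simp only [Real.fourierInv_eq_fourier_neg]
  exact Real.fourier_mul_convolution_eq hF hG _

theorem norm_fourierInv_le {d : ℕ} (F : Space d → ℂ) (x : Space d) : ‖𝓕⁻ F x‖ ≤ ∫ η, ‖F η‖ := by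
  exact VectorFourier.norm_fourierIntegral_le_integral_norm _ _ _ _ _

theorem fourierInv_star {d : ℕ} (F : Space d → ℂ) (x : Space d) :
    𝓕⁻ (fun η => (starRingEnd ℂ) (F (-η))) x = (starRingEnd ℂ) (𝓕⁻ F x) := by
  simp only [Real.fourierInv_eq']
  rw [← integral_conj, ← integral_neg_eq_self]
  refine integral_congr_ae (Filter.Eventually.of_forall fun η => ?_)
  simp [← Complex.exp_conj, map_ofNat]

theorem memLp_mul_of_bounded {d : ℕ} {m : Space d → ℂ} (hm : Measurable m) {C : ℝ}
    (hC : ∀ ξ, ‖m ξ‖ ≤ C) (f : L2 d) :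
    MemLp (fun η : Space d => m ((2 * Real.pi) • η) * f η) 2 volume :=
  (Lp.memLp f).of_le_mul (c := C)
    ((hm.comp (measurable_const_smul _)).aestronglyMeasurable.mul (Lp.aestronglyMeasurable f))
    (Filter.Eventually.of_forall fun η => by
      rw [norm_mul]; gcongr; exact hC _)

theorem coeFn_fourier_fourierMul {d : ℕ} {m : Space d → ℂ} (hm : Measurable m) {C : ℝ}
    (hC : ∀ ξ, ‖m ξ‖ ≤ C) (f : L2 d) :
    ((𝓕 (fourierMul m f) : L2 d) : Space d → ℂ) =ᵐ[volume]
      fun η => m ((2 * Real.pi) • η) * (𝓕 f : L2 d) η := by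
  have h := memLp_mul_of_bounded hm hC (𝓕 f : L2 d)
  rw [fourierMul, dif_pos h, FourierTransform.fourier_fourierInv_eq]
  exact h.coeFn_toLp

theorem L2.ext_fourier {d : ℕ} {f g : L2 d}
    (h : ((𝓕 f : L2 d) : Space d → ℂ) =ᵐ[volume] ((𝓕 g : L2 d) : Space d → ℂ)) : f = g :=
  (Lp.fourierTransformₗᵢ (Space d) ℂ).injective (Lp.ext h)

theorem L2.fourier_add {d : ℕ} (f g : L2 d) : (𝓕 (f + g) : L2 d) = 𝓕 f + 𝓕 g :=
  (Lp.fourierTransformₗᵢ (Space d) ℂ).map_add f g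

theorem L2.fourier_sub {d : ℕ} (f g : L2 d) : (𝓕 (f - g) : L2 d) = 𝓕 f - 𝓕 g :=
  (Lp.fourierTransformₗᵢ (Space d) ℂ).map_sub f g

theorem L2.fourier_smul {d : ℕ} (c : ℂ) (f : L2 d) : (𝓕 (c • f) : L2 d) = c • (𝓕 f : L2 d) :=
  (Lp.fourierTransformₗᵢ (Space d) ℂ).map_smul c f

/-- A bounded Fourier multiplier as a continuous linear map. -/
noncomputable def fourierMulCLM {d : ℕ} (m : Space d → ℂ) (hm : Measurable m) (C : ℝ)
    (hC : ∀ ξ, ‖m ξ‖ ≤ C) : L2 d →L[ℂ] L2 d :=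
  LinearMap.mkContinuous
    { toFun := fourierMul m
      map_add' := fun f g => by
        apply L2.ext_fourier
        rw [L2.fourier_add]
        filter_upwards [coeFn_fourier_fourierMul hm hC (f + g), coeFn_fourier_fourierMul hm hC f,
          coeFn_fourier_fourierMul hm hC g, Lp.coeFn_add (𝓕 f : L2 d) (𝓕 g),
          Lp.coeFn_add (𝓕 (fourierMul m f) : L2 d) (𝓕 (fourierMul m g))] with η h1 h2 h3 h4 h5
        rw [h1, h5, L2.fourier_add, Pi.add_apply, h2, h3, h4, Pi.add_apply, mul_add]
      map_smul' := fun c f => by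
        apply L2.ext_fourier
        rw [L2.fourier_smul]
        filter_upwards [coeFn_fourier_fourierMul hm hC (c • f), coeFn_fourier_fourierMul hm hC f,
          Lp.coeFn_smul c (𝓕 f : L2 d),
          Lp.coeFn_smul c (𝓕 (fourierMul m f) : L2 d)] with η h1 h2 h4 h5
        rw [RingHom.id_apply, h1, h5, L2.fourier_smul, Pi.smul_apply, h2, h4, Pi.smul_apply,
          smul_eq_mul, smul_eq_mul]
        ring } C
    (fun f => by
      change ‖fourierMul m f‖ ≤ C * ‖f‖
      rw [← Lp.norm_fourier_eq, ← Lp.norm_fourier_eq f]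
      refine Lp.norm_le_mul_norm_of_ae_le_mul ?_
      filter_upwards [coeFn_fourier_fourierMul hm hC f] with η h
      rw [h, norm_mul]
      gcongr
      exact hC _)

@[simp] theorem fourierMulCLM_apply {d : ℕ} {m : Space d → ℂ} (hm : Measurable m) {C : ℝ}
    (hC : ∀ ξ, ‖m ξ‖ ≤ C) (f : L2 d) : fourierMulCLM m hm C hC f = fourierMul m f := rfl

theorem L2.enorm_eq {d : ℕ} (f : L2 d) : ‖f‖ₑ = (∫⁻ η, ‖f η‖ₑ ^ 2) ^ (1 / 2 : ℝ) := by
  rw [Lp.enorm_def, eLpNorm_eq_lintegral_rpow_enorm_toReal (by norm_num) (by norm_num)]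
  simp

/-! ### The Sobolev norm as a supremum of norms of bounded operators -/

/-- The symbol `⟨ξ⟩^s` truncated at height `N`. -/
noncomputable def truncSymbol {d : ℕ} (s : ℝ) (N : ℕ) (ξ : Space d) : ℂ :=
  ((min ((1 + ‖ξ‖ ^ 2) ^ (s / 2)) (N : ℝ) : ℝ) : ℂ)

theorem measurable_truncSymbol {d : ℕ} (s : ℝ) (N : ℕ) :
    Measurable (truncSymbol s N : Space d → ℂ) := by
  unfold truncSymbol
  fun_prop

theorem norm_truncSymbol {d : ℕ} (s : ℝ) (N : ℕ) (ξ : Space d) :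
    ‖truncSymbol s N ξ‖ = min ((1 + ‖ξ‖ ^ 2) ^ (s / 2)) (N : ℝ) := by
  rw [truncSymbol, Complex.norm_real, Real.norm_eq_abs, abs_of_nonneg (by positivity)]

theorem norm_truncSymbol_le {d : ℕ} (s : ℝ) (N : ℕ) (ξ : Space d) : ‖truncSymbol s N ξ‖ ≤ N := by
  rw [norm_truncSymbol]; exact min_le_right _ _

/-- The truncated Bessel operator. -/
noncomputable def truncBessel (d : ℕ) (s : ℝ) (N : ℕ) : L2 d →L[ℂ] L2 d :=
  fourierMulCLM (truncSymbol s N) (measurable_truncSymbol s N) N (norm_truncSymbol_le s N)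

theorem enorm_truncBessel {d : ℕ} (s : ℝ) (N : ℕ) (f : L2 d) :
    ‖truncBessel d s N f‖ₑ = (∫⁻ η : Space d,
      ENNReal.ofReal (min ((1 + ‖(2 * Real.pi) • η‖ ^ 2) ^ (s / 2)) (N : ℝ) ^ 2) *
        ‖(𝓕 f : L2 d) η‖ₑ ^ 2) ^ (1 / 2 : ℝ) := by
  have h0 : ‖truncBessel d s N f‖ₑ = ‖(𝓕 (truncBessel d s N f) : L2 d)‖ₑ := by
    rw [← ofReal_norm, ← ofReal_norm, Lp.norm_fourier_eq]
  rw [h0, L2.enorm_eq]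
  congr 1
  refine lintegral_congr_ae ?_
  filter_upwards [coeFn_fourier_fourierMul (measurable_truncSymbol s N)
    (norm_truncSymbol_le s N) f] with η h
  rw [truncBessel, fourierMulCLM_apply, h, enorm_mul, mul_pow, ← ofReal_norm (truncSymbol _ _ _),
    norm_truncSymbol, ENNReal.ofReal_pow (by positivity)]

/-- Monotone convergence in the truncation height. Each term is the norm of a bounded operator
applied to `f`, so the triangle inequality, Minkowski's inequality, lower semicontinuity and
continuity in time all reduce to facts about continuous linear maps on `L²`. -/
theorem sobolevNorm_eq_iSup {d : ℕ} (s : ℝ) (f : L2 d) :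
    sobolevNorm s f = ⨆ N : ℕ, ‖truncBessel d s N f‖ₑ := by
  simp only [enorm_truncBessel, sobolevNorm]
  have h := (ENNReal.orderIsoRpow (1 / 2 : ℝ) (by norm_num)).map_iSup (fun N : ℕ => ∫⁻ η : Space d,
      ENNReal.ofReal (min ((1 + ‖(2 * Real.pi) • η‖ ^ 2) ^ (s / 2)) (N : ℝ) ^ 2) *
        ‖(𝓕 f : L2 d) η‖ₑ ^ 2)
  simp only [ENNReal.orderIsoRpow_apply] at h
  rw [← h]
  congr 1
  rw [← lintegral_iSup']
  · refine lintegral_congr fun η => ?_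
    rw [← ENNReal.iSup_mul]
    congr 1
    have hw : (0 : ℝ) < 1 + ‖(2 * Real.pi) • η‖ ^ 2 := by positivity
    have hsq : ((1 + ‖(2 * Real.pi) • η‖ ^ 2) ^ (s / 2)) ^ 2 = (1 + ‖(2 * Real.pi) • η‖ ^ 2) ^ s := by
      rw [← Real.rpow_mul_natCast hw.le]; norm_num
    apply le_antisymm
    · obtain ⟨N, hN⟩ := exists_nat_ge ((1 + ‖(2 * Real.pi) • η‖ ^ 2) ^ (s / 2))
      refine le_iSup_of_le N ?_
      rw [min_eq_left hN, hsq]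
    · refine iSup_le fun N => ENNReal.ofReal_le_ofReal ?_
      rw [← hsq]
      gcongr
      exact min_le_left _ _
  · intro N
    have := (Lp.aestronglyMeasurable (𝓕 f : L2 d)).aemeasurable
    fun_prop
  · refine Filter.Eventually.of_forall fun η N M hNM => ?_
    dsimp only
    gcongr

theorem sobolevNorm_le_iff {d : ℕ} {s : ℝ} {f : L2 d} {A : ℝ≥0} :
    sobolevNorm s f ≤ A ↔ ∀ N : ℕ, ‖truncBessel d s N f‖ ≤ A := by
  rw [sobolevNorm_eq_iSup, iSup_le_iff]
  simp only [enorm_le_coe, ← NNReal.coe_le_coe, coe_nnnorm]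

theorem sobolevNorm_add_le {d : ℕ} (s : ℝ) (f g : L2 d) :
    sobolevNorm s (f + g) ≤ sobolevNorm s f + sobolevNorm s g := by
  simp only [sobolevNorm_eq_iSup]
  refine iSup_le fun N => ?_
  rw [map_add]
  exact (enorm_add_le _ _).trans
    (add_le_add (le_iSup (fun N => ‖truncBessel d s N f‖ₑ) N)
      (le_iSup (fun N => ‖truncBessel d s N g‖ₑ) N))

theorem sobolevNorm_smul {d : ℕ} (s : ℝ) (c : ℂ) (f : L2 d) :
    sobolevNorm s (c • f) = ‖c‖ₑ * sobolevNorm s f := by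
  simp only [sobolevNorm_eq_iSup, map_smul, enorm_smul, ENNReal.mul_iSup]

theorem sobolevNorm_neg {d : ℕ} (s : ℝ) (f : L2 d) : sobolevNorm s (-f) = sobolevNorm s f := by
  simp only [sobolevNorm_eq_iSup, map_neg, enorm_neg]

theorem sobolevNorm_sub_le {d : ℕ} (s : ℝ) (f g : L2 d) :
    sobolevNorm s (f - g) ≤ sobolevNorm s f + sobolevNorm s g := by
  rw [sub_eq_add_neg, ← sobolevNorm_neg s g]
  exact sobolevNorm_add_le _ _ _

theorem sobolevNorm_zero {d : ℕ} (s : ℝ) : sobolevNorm s (0 : L2 d) = 0 := by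
  simp [sobolevNorm_eq_iSup]

/-- Lower semicontinuity of the Sobolev norm under `L²` convergence. -/
theorem sobolevNorm_le_of_tendsto {d : ℕ} {s : ℝ} {f : ℕ → L2 d} {g : L2 d} {A : ℝ≥0}
    (h : Filter.Tendsto f Filter.atTop (nhds g)) (hf : ∀ n, sobolevNorm s (f n) ≤ A) :
    sobolevNorm s g ≤ A := by
  rw [sobolevNorm_le_iff]
  intro N
  exact le_of_tendsto ((((truncBessel d s N).continuous.tendsto g).comp h).norm)
    (Filter.Eventually.of_forall fun n => sobolevNorm_le_iff.1 (hf n) N)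

/-- Minkowski's inequality for the Sobolev norm of an `L²`-valued integral. -/
theorem sobolevNorm_intervalIntegral_le {d : ℕ} {s a b : ℝ} (hab : a ≤ b) {G : ℝ → L2 d}
    (hG : IntervalIntegrable G volume a b) {Φ : ℝ → ℝ} (hΦ : IntervalIntegrable Φ volume a b)
    (h : ∀ᵐ τ ∂(volume.restrict (Ioc a b)), sobolevNorm s (G τ) ≤ ENNReal.ofReal (Φ τ))
    (hΦ0 : ∀ τ ∈ Ioc a b, 0 ≤ Φ τ) :
    sobolevNorm s (∫ τ in a..b, G τ) ≤ ENNReal.ofReal (∫ τ in a..b, Φ τ) := by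
  rw [ENNReal.ofReal, sobolevNorm_le_iff]
  intro N
  rw [← ContinuousLinearMap.intervalIntegral_comp_comm _ hG]
  refine (intervalIntegral.norm_integral_le_of_norm_le hab ?_ hΦ).trans (Real.le_coe_toNNReal _)
  rw [ae_restrict_iff' measurableSet_Ioc] at h
  filter_upwards [h] with τ hτ hmem
  have := sobolevNorm_le_iff.1 (hτ hmem) N
  rwa [Real.coe_toNNReal _ (hΦ0 τ hmem)] at this

/-! ### Weighted estimates on the Fourier side -/

/-- The weight `⟨ξ⟩^{2s}` at `ξ = 2πη`, with values in `[0, ∞]`. -/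
noncomputable def sobolevWeight {d : ℕ} (s : ℝ) (η : Space d) : ℝ≥0∞ :=
  ENNReal.ofReal ((1 + ‖(2 * Real.pi) • η‖ ^ 2) ^ s)

theorem measurable_sobolevWeight {d : ℕ} (s : ℝ) : Measurable (sobolevWeight s : Space d → ℝ≥0∞) := by
  unfold sobolevWeight
  fun_prop

theorem sobolevWeight_add {d : ℕ} (s t : ℝ) (η : Space d) :
    sobolevWeight (s + t) η = sobolevWeight s η * sobolevWeight t η := by
  unfold sobolevWeight
  rw [Real.rpow_add (by positivity), ENNReal.ofReal_mul (by positivity)]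

theorem sobolevWeight_zero {d : ℕ} (η : Space d) : sobolevWeight 0 η = 1 := by
  simp [sobolevWeight]

theorem one_le_sobolevWeight {d : ℕ} {s : ℝ} (hs : 0 ≤ s) (η : Space d) :
    1 ≤ sobolevWeight s η := by
  unfold sobolevWeight
  rw [ENNReal.one_le_ofReal]
  exact Real.one_le_rpow (by nlinarith [sq_nonneg ‖(2 * Real.pi) • η‖]) hs

/-- Peetre-type bound: the weight at `ξ` is controlled by the larger of the weights at `η` and `ξ -
η`, and so cancels one of the two negative powers. The right side has an integral over `η` that does
not depend on `ξ`. -/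
theorem sobolevWeight_mul_le {d : ℕ} {s : ℝ} (hs : 0 ≤ s) (ξ η : Space d) :
    sobolevWeight s ξ * (sobolevWeight (-s) η * sobolevWeight (-s) (ξ - η)) ≤
      ENNReal.ofReal (4 ^ s) * (sobolevWeight (-s) η + sobolevWeight (-s) (ξ - η)) := by
  unfold sobolevWeight
  set x := 1 + ‖(2 * Real.pi) • ξ‖ ^ 2
  set a := 1 + ‖(2 * Real.pi) • η‖ ^ 2 with ha
  set b := 1 + ‖(2 * Real.pi) • (ξ - η)‖ ^ 2 with hb
  have ha0 : 0 < a := by positivity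
  have hb0 : 0 < b := by positivity
  -- From `(p + q)² ≤ 2p² + 2q²`, which gives `x ≤ 2a + 2b`.
  have hx : x ≤ 4 * max a b := by
    have h1 : ‖(2 * Real.pi) • ξ‖ ≤ ‖(2 * Real.pi) • η‖ + ‖(2 * Real.pi) • (ξ - η)‖ := by
      refine le_of_eq_of_le ?_ (norm_add_le _ _)
      rw [← smul_add, add_sub_cancel]
    have h2 : ‖(2 * Real.pi) • ξ‖ ^ 2 ≤ (‖(2 * Real.pi) • η‖ + ‖(2 * Real.pi) • (ξ - η)‖) ^ 2 := by
      gcongr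
    nlinarith [le_max_left a b, le_max_right a b,
      sq_nonneg (‖(2 * Real.pi) • η‖ - ‖(2 * Real.pi) • (ξ - η)‖)]
  have hxs : x ^ s ≤ 4 ^ s * (a ^ s + b ^ s) := by
    calc x ^ s ≤ (4 * max a b) ^ s := Real.rpow_le_rpow (by positivity) hx hs
      _ = 4 ^ s * (max a b) ^ s := Real.mul_rpow (by norm_num) (by positivity)
      _ ≤ 4 ^ s * (a ^ s + b ^ s) := by
        gcongr
        have := Real.rpow_nonneg ha0.le s
        have := Real.rpow_nonneg hb0.le s
        rcases max_choice a b with h | h <;> rw [h] <;> linarith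
  rw [← ENNReal.ofReal_mul (by positivity), ← ENNReal.ofReal_mul (by positivity),
    ← ENNReal.ofReal_add (by positivity) (by positivity), ← ENNReal.ofReal_mul (by positivity)]
  apply ENNReal.ofReal_le_ofReal
  rw [Real.rpow_neg ha0.le, Real.rpow_neg hb0.le]
  have h1 := Real.rpow_pos_of_pos ha0 s
  have h2 := Real.rpow_pos_of_pos hb0 s
  calc x ^ s * ((a ^ s)⁻¹ * (b ^ s)⁻¹)
      ≤ 4 ^ s * (a ^ s + b ^ s) * ((a ^ s)⁻¹ * (b ^ s)⁻¹) := by gcongr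
    _ = 4 ^ s * ((a ^ s)⁻¹ + (b ^ s)⁻¹) := by field_simp; ring

/-- The constant `∫ ⟨2πη⟩^{-2s} dη`. -/
noncomputable def sobolevConst (d : ℕ) (s : ℝ) : ℝ≥0∞ := ∫⁻ η : Space d, sobolevWeight (-s) η

theorem sobolevConst_lt_top {d : ℕ} {s : ℝ} (hs : (d : ℝ) / 2 < s) : sobolevConst d s < ⊤ := by
  have h1 : Integrable fun x : Space d => (1 + ‖x‖ ^ 2) ^ (-(2 * s) / 2) :=
    integrable_rpow_neg_one_add_norm_sq (by rw [finrank_euclideanSpace_fin]; linarith)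
  have h2 := h1.comp_smul (R := 2 * Real.pi) (by positivity)
  refine lt_of_eq_of_lt ?_ h2.lintegral_lt_top
  refine lintegral_congr fun η => ?_
  rw [sobolevWeight]
  congr 2
  ring

theorem sobolevNorm_sq {d : ℕ} (s : ℝ) (f : L2 d) :
    sobolevNorm s f ^ 2 = ∫⁻ η, sobolevWeight s η * ‖(𝓕 f : L2 d) η‖ₑ ^ 2 := by
  unfold sobolevNorm sobolevWeight
  rw [← ENNReal.rpow_natCast, ← ENNReal.rpow_mul]
  norm_num

theorem lintegral_mul_sq_le {α : Type*} [MeasurableSpace α] {μ : Measure α} {φ ψ : α → ℝ≥0∞}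
    (hφ : AEMeasurable φ μ) (hψ : AEMeasurable ψ μ) :
    (∫⁻ x, φ x * ψ x ∂μ) ^ 2 ≤ (∫⁻ x, φ x ^ 2 ∂μ) * ∫⁻ x, ψ x ^ 2 ∂μ := by
  have h := ENNReal.lintegral_mul_le_Lp_mul_Lq μ Real.HolderConjugate.two_two hφ hψ
  have h2 := pow_le_pow_left' h 2
  rw [mul_pow, ← ENNReal.rpow_natCast (_ ^ (1 / 2 : ℝ)), ← ENNReal.rpow_natCast (_ ^ (1 / 2 : ℝ)),
    ← ENNReal.rpow_mul, ← ENNReal.rpow_mul] at h2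
  simpa using h2

theorem L2.measurable_enorm {d : ℕ} (f : L2 d) : Measurable fun η => ‖f η‖ₑ :=
  (Lp.stronglyMeasurable f).measurable.enorm

/-- Cauchy–Schwarz for the factorisation `|f̂| = ⟨ξ⟩^{-s} · ⟨ξ⟩^s |f̂|`. For `s > d/2` it makes `f̂`
integrable, so that `f` is a genuine inverse Fourier integral. -/
theorem lintegral_enorm_fourier_sq_le {d : ℕ} (s : ℝ) (f : L2 d) :
    (∫⁻ η, ‖(𝓕 f : L2 d) η‖ₑ) ^ 2 ≤ sobolevConst d s * sobolevNorm s f ^ 2 := by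
  have hF := L2.measurable_enorm (𝓕 f : L2 d)
  have hw := fun r => measurable_sobolevWeight (d := d) r
  have h := lintegral_mul_sq_le (μ := (volume : Measure (Space d)))
    (φ := fun η => sobolevWeight (-s / 2) η)
    (ψ := fun η => sobolevWeight (s / 2) η * ‖(𝓕 f : L2 d) η‖ₑ)
    (hw _).aemeasurable ((hw _).mul hF).aemeasurable
  rw [sobolevNorm_sq, sobolevConst]
  convert h using 2
  · refine lintegral_congr fun η => ?_
    rw [← mul_assoc, ← sobolevWeight_add, show -s / 2 + s / 2 = 0 by ring, sobolevWeight_zero,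
      one_mul]
  · refine lintegral_congr fun η => ?_
    rw [sq, ← sobolevWeight_add]; congr 1; ring
  · refine lintegral_congr fun η => ?_
    rw [mul_pow, sq (sobolevWeight _ _), ← sobolevWeight_add]; congr 2; ring

theorem integrable_fourier {d : ℕ} {s : ℝ} (hs : (d : ℝ) / 2 < s) {f : L2 d}
    (hf : sobolevNorm s f < ⊤) : Integrable (𝓕 f : L2 d) := by
  refine ⟨Lp.aestronglyMeasurable _, ?_⟩
  have h := lintegral_enorm_fourier_sq_le s f
  have h2 : (∫⁻ η, ‖(𝓕 f : L2 d) η‖ₑ) ^ 2 < ⊤ :=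
    h.trans_lt (ENNReal.mul_lt_top (sobolevConst_lt_top hs) (ENNReal.pow_lt_top hf))
  exact (ENNReal.pow_lt_top_iff.1 h2).resolve_right (by norm_num)

theorem coeFn_eq_fourierInv {d : ℕ} {f : L2 d} (hf : Integrable (𝓕 f : L2 d)) :
    (f : Space d → ℂ) =ᵐ[volume] 𝓕⁻ ((𝓕 f : L2 d) : Space d → ℂ) := by
  have h := coeFn_fourierInv_toLp hf (Lp.memLp (𝓕 f : L2 d))
  rwa [Lp.toLp_coeFn, FourierTransform.fourierInv_fourier_eq] at h

/-- An `L²` element with prescribed Fourier transform. -/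
theorem exists_L2_eq_fourierInv {d : ℕ} {H : Space d → ℂ} {s : ℝ} (hs : 0 ≤ s) {A : ℝ≥0∞}
    (hA : A < ⊤)
    (h1 : Integrable H) (h2 : ∫⁻ η, sobolevWeight s η * ‖H η‖ₑ ^ 2 ≤ A ^ 2) :
    ∃ f : L2 d, (f : Space d → ℂ) =ᵐ[volume] 𝓕⁻ H ∧ sobolevNorm s f ≤ A := by
  have hm : MemLp H 2 volume := by
    refine ⟨h1.aestronglyMeasurable, ?_⟩
    rw [eLpNorm_lt_top_iff_lintegral_rpow_enorm_lt_top (by norm_num) (by norm_num)]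
    refine lt_of_le_of_lt ?_ (h2.trans_lt (ENNReal.pow_lt_top hA))
    refine lintegral_mono fun η => ?_
    simpa using le_mul_of_one_le_left (zero_le (a := ‖H η‖ₑ ^ 2)) (one_le_sobolevWeight hs η)
  refine ⟨𝓕⁻ (hm.toLp H : L2 d), coeFn_fourierInv_toLp h1 hm, ?_⟩
  have h3 : sobolevNorm s (𝓕⁻ (hm.toLp H : L2 d) : L2 d) ^ 2 ≤ A ^ 2 := by
    rw [sobolevNorm_sq, FourierTransform.fourier_fourierInv_eq]
    refine le_of_eq_of_le (lintegral_congr_ae ?_) h2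
    filter_upwards [hm.coeFn_toLp] with η h
    rw [h]
  exact (ENNReal.pow_le_pow_left_iff two_ne_zero).1 h3

theorem enorm_convolution_le {d : ℕ} (F G : Space d → ℂ) (ξ : Space d) :
    ‖convolution F G (ContinuousLinearMap.mul ℂ ℂ) volume ξ‖ₑ ≤ ∫⁻ η, ‖F η‖ₑ * ‖G (ξ - η)‖ₑ := by
  rw [convolution_def]
  refine (enorm_integral_le_lintegral_enorm _).trans_eq (lintegral_congr fun η => ?_)
  simp [enorm_mul]

/-- The weighted Young inequality behind the algebra property of `H^s`. -/
theorem lintegral_weight_convolution_le {d : ℕ} {s : ℝ} (hs : 0 ≤ s) {F G : Space d → ℂ}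
    (hF : Measurable F) (hG : Measurable G) :
    ∫⁻ ξ, sobolevWeight s ξ * ‖convolution F G (ContinuousLinearMap.mul ℂ ℂ) volume ξ‖ₑ ^ 2 ≤
      ENNReal.ofReal (4 ^ s) * (2 * sobolevConst d s) *
        ((∫⁻ η, sobolevWeight s η * ‖F η‖ₑ ^ 2) * ∫⁻ η, sobolevWeight s η * ‖G η‖ₑ ^ 2) := by
  have hw := fun r => measurable_sobolevWeight (d := d) r
  set a : Space d → ℝ≥0∞ := fun η => sobolevWeight s η * ‖F η‖ₑ ^ 2 with ha
  set b : Space d → ℝ≥0∞ := fun η => sobolevWeight s η * ‖G η‖ₑ ^ 2 with hb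
  have ham : Measurable a := by have := hw s; fun_prop
  have hbm : Measurable b := by have := hw s; fun_prop
  have key : ∀ ξ, sobolevWeight s ξ *
      ‖convolution F G (ContinuousLinearMap.mul ℂ ℂ) volume ξ‖ₑ ^ 2 ≤
      ENNReal.ofReal (4 ^ s) * (2 * sobolevConst d s) * ∫⁻ η, a η * b (ξ - η) := by
    intro ξ
    have hsub : Measurable fun η : Space d => ξ - η := measurable_const.sub measurable_id
    -- Cauchy–Schwarz, with the negative weights at `η` and `ξ - η` on one factor and their inverses
    -- on `F` and `G`.
    have h1 : (∫⁻ η, ‖F η‖ₑ * ‖G (ξ - η)‖ₑ) ^ 2 ≤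
        (∫⁻ η, sobolevWeight (-s) η * sobolevWeight (-s) (ξ - η)) * ∫⁻ η, a η * b (ξ - η) := by
      have h := lintegral_mul_sq_le (μ := (volume : Measure (Space d)))
        (φ := fun η => sobolevWeight (-s / 2) η * sobolevWeight (-s / 2) (ξ - η))
        (ψ := fun η => (sobolevWeight (s / 2) η * ‖F η‖ₑ) *
          (sobolevWeight (s / 2) (ξ - η) * ‖G (ξ - η)‖ₑ))
        (((hw _).mul ((hw _).comp hsub)).aemeasurable)
        ((((hw _).mul hF.enorm).mul (((hw _).mul hG.enorm).comp hsub)).aemeasurable)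
      convert h using 2
      · refine lintegral_congr fun η => ?_
        have e : ∀ ζ : Space d, sobolevWeight (-s / 2) ζ * sobolevWeight (s / 2) ζ = 1 := by
          intro ζ
          rw [← sobolevWeight_add, show -s / 2 + s / 2 = 0 by ring, sobolevWeight_zero]
        calc _ = (sobolevWeight (-s / 2) η * sobolevWeight (s / 2) η) *
              (sobolevWeight (-s / 2) (ξ - η) * sobolevWeight (s / 2) (ξ - η)) *
              (‖F η‖ₑ * ‖G (ξ - η)‖ₑ) := by rw [e, e]; simp
          _ = _ := by ring
      · refine lintegral_congr fun η => ?_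
        rw [mul_pow, sq, sq, ← sobolevWeight_add, ← sobolevWeight_add]
        congr 2 <;> ring_nf
      · refine lintegral_congr fun η => ?_
        rw [ha, hb, mul_pow, mul_pow, mul_pow, sq (sobolevWeight _ η),
          sq (sobolevWeight _ (ξ - η)), ← sobolevWeight_add, ← sobolevWeight_add]
        congr 3 <;> ring_nf
    have h2 : sobolevWeight s ξ * (∫⁻ η, sobolevWeight (-s) η * sobolevWeight (-s) (ξ - η)) ≤
        ENNReal.ofReal (4 ^ s) * (2 * sobolevConst d s) := by
      have hm : ∀ r, Measurable fun η : Space d => sobolevWeight r (ξ - η) :=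
        fun r => (hw r).comp hsub
      have hm1 : Measurable fun η : Space d => sobolevWeight (-s) η * sobolevWeight (-s) (ξ - η) :=
        (hw _).mul (hm _)
      have hm2 : Measurable fun η : Space d => sobolevWeight (-s) η + sobolevWeight (-s) (ξ - η) :=
        (hw _).add (hm _)
      rw [← lintegral_const_mul _ hm1]
      refine (lintegral_mono fun η => sobolevWeight_mul_le hs ξ η).trans_eq ?_
      rw [lintegral_const_mul _ hm2, lintegral_add_left (hw _),
        lintegral_sub_left_eq_self (fun η => sobolevWeight (-s) η) ξ, two_mul]
      rfl
    calc _ ≤ sobolevWeight s ξ * (∫⁻ η, ‖F η‖ₑ * ‖G (ξ - η)‖ₑ) ^ 2 := by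
          gcongr; exact enorm_convolution_le F G ξ
      _ ≤ sobolevWeight s ξ * ((∫⁻ η, sobolevWeight (-s) η * sobolevWeight (-s) (ξ - η)) *
          ∫⁻ η, a η * b (ξ - η)) := by gcongr
      _ ≤ _ := by rw [← mul_assoc]; gcongr
  refine (lintegral_mono key).trans_eq ?_
  have hm2 : Measurable fun p : Space d × Space d => a p.2 * b (p.1 - p.2) :=
    (ham.comp measurable_snd).mul (hbm.comp (measurable_fst.sub measurable_snd))
  rw [lintegral_const_mul _ hm2.lintegral_prod_right', lintegral_lintegral_swap hm2.aemeasurable]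
  congr 1
  rw [← lintegral_mul_const _ ham]
  refine lintegral_congr fun η => ?_
  have hm3 : Measurable fun ξ : Space d => b (ξ - η) := hbm.comp (measurable_id.sub_const η)
  dsimp only
  rw [lintegral_const_mul _ hm3]
  congr 1
  exact lintegral_sub_right_eq_self b η

/-! ### Calculus in `H^s`: products, sup bound, conjugation, powers -/

/-- `f` agrees almost everywhere with an element of `L²` of `H^s` norm at most `A`. -/
def HasSobolevBound {d : ℕ} (s : ℝ) (f : Space d → ℂ) (A : ℝ≥0) : Prop :=
  ∃ g : L2 d, (g : Space d → ℂ) =ᵐ[volume] f ∧ sobolevNorm s g ≤ A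

namespace HasSobolevBound

variable {d : ℕ} {s : ℝ} {f g : Space d → ℂ} {A B : ℝ≥0}

theorem congr (hf : HasSobolevBound s f A) (h : f =ᵐ[volume] g) : HasSobolevBound s g A := by
  obtain ⟨F, hF, hA⟩ := hf
  exact ⟨F, hF.trans h, hA⟩

theorem mono (hf : HasSobolevBound s f A) (h : A ≤ B) : HasSobolevBound s f B := by
  obtain ⟨F, hF, hA⟩ := hf
  exact ⟨F, hF, hA.trans (by exact_mod_cast h)⟩

theorem of_L2 {f : L2 d} (h : sobolevNorm s f ≤ A) : HasSobolevBound s f A :=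
  ⟨f, Filter.EventuallyEq.rfl, h⟩

theorem sobolevNorm_le {f : L2 d} (h : HasSobolevBound s f A) : sobolevNorm s f ≤ A := by
  obtain ⟨F, hF, hA⟩ := h
  rwa [← Lp.ext hF]

theorem add (hf : HasSobolevBound s f A) (hg : HasSobolevBound s g B) :
    HasSobolevBound s (fun x => f x + g x) (A + B) := by
  obtain ⟨F, hF, hA⟩ := hf
  obtain ⟨G, hG, hB⟩ := hg
  refine ⟨F + G, ?_, (sobolevNorm_add_le s F G).trans (by push_cast; gcongr)⟩
  filter_upwards [hF, hG, Lp.coeFn_add F G] with x h1 h2 h3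
  rw [h3, Pi.add_apply, h1, h2]

theorem sub (hf : HasSobolevBound s f A) (hg : HasSobolevBound s g B) :
    HasSobolevBound s (fun x => f x - g x) (A + B) := by
  obtain ⟨F, hF, hA⟩ := hf
  obtain ⟨G, hG, hB⟩ := hg
  refine ⟨F - G, ?_, (sobolevNorm_sub_le s F G).trans (by push_cast; gcongr)⟩
  filter_upwards [hF, hG, Lp.coeFn_sub F G] with x h1 h2 h3
  rw [h3, Pi.sub_apply, h1, h2]

theorem const_mul (c : ℂ) (hf : HasSobolevBound s f A) :
    HasSobolevBound s (fun x => c * f x) (‖c‖₊ * A) := by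
  obtain ⟨F, hF, hA⟩ := hf
  refine ⟨c • F, ?_, ?_⟩
  · filter_upwards [hF, Lp.coeFn_smul c F] with x h1 h3
    rw [h3, Pi.smul_apply, h1, smul_eq_mul]
  · rw [sobolevNorm_smul]; push_cast; gcongr; rfl

end HasSobolevBound

/-- `H^s` is an algebra for `s > d/2`. -/
theorem exists_hasSobolevBound_mul {d : ℕ} {s : ℝ} (hs : (d : ℝ) / 2 < s) :
    ∃ K : ℝ≥0, ∀ (f g : Space d → ℂ) (A B : ℝ≥0), HasSobolevBound s f A →
      HasSobolevBound s g B → HasSobolevBound s (fun x => f x * g x) (K * A * B) := by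
  have hs0 : 0 ≤ s := le_trans (by positivity) hs.le
  have hκ : ENNReal.ofReal (4 ^ s) * (2 * sobolevConst d s) < ⊤ :=
    ENNReal.mul_lt_top ENNReal.ofReal_lt_top
      (ENNReal.mul_lt_top (by norm_num) (sobolevConst_lt_top hs))
  set κ := ENNReal.ofReal (4 ^ s) * (2 * sobolevConst d s) with hκdef
  refine ⟨(κ ^ (1 / 2 : ℝ)).toNNReal, ?_⟩
  rintro f g A B ⟨F, hF, hA⟩ ⟨G, hG, hB⟩
  have hF1 := integrable_fourier hs (hA.trans_lt ENNReal.coe_lt_top)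
  have hG1 := integrable_fourier hs (hB.trans_lt ENNReal.coe_lt_top)
  set H := convolution ((𝓕 F : L2 d) : Space d → ℂ) ((𝓕 G : L2 d) : Space d → ℂ)
    (ContinuousLinearMap.mul ℂ ℂ) volume with hH
  have hH1 : Integrable H := hF1.integrable_convolution _ hG1
  have hroot : κ ^ (1 / 2 : ℝ) < ⊤ := ENNReal.rpow_lt_top_of_nonneg (by norm_num) hκ.ne
  obtain ⟨h, hh, hhn⟩ := exists_L2_eq_fourierInv (d := d) (H := H) (s := s) hs0
    (A := (((κ ^ (1 / 2 : ℝ)).toNNReal * A * B : ℝ≥0) : ℝ≥0∞)) ENNReal.coe_lt_top hH1 (by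
      refine (lintegral_weight_convolution_le hs0 (Lp.stronglyMeasurable _).measurable
        (Lp.stronglyMeasurable _).measurable).trans ?_
      rw [← sobolevNorm_sq, ← sobolevNorm_sq]
      push_cast
      rw [ENNReal.coe_toNNReal hroot.ne, mul_pow, mul_pow, mul_assoc (_ ^ 2),
        ← ENNReal.rpow_natCast (κ ^ (1 / 2 : ℝ)), ← ENNReal.rpow_mul]
      norm_num
      gcongr)
  refine ⟨h, ?_, hhn⟩
  filter_upwards [hh, hF, hG, coeFn_eq_fourierInv hF1, coeFn_eq_fourierInv hG1] with x h1 h2 h3 h4 h5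
  rw [h1, hH, fourierInv_convolution hF1 hG1, ← h4, ← h5, h2, h3]

/-- The Sobolev embedding `H^s ⊆ L^∞` for `s > d/2`. -/
theorem exists_norm_le_of_hasSobolevBound {d : ℕ} {s : ℝ} (hs : (d : ℝ) / 2 < s) :
    ∃ K : ℝ≥0, ∀ (f : Space d → ℂ) (A : ℝ≥0), HasSobolevBound s f A →
      ∀ᵐ x, ‖f x‖ ≤ K * A := by
  have hκ := sobolevConst_lt_top hs
  have hroot : sobolevConst d s ^ (1 / 2 : ℝ) < ⊤ :=
    ENNReal.rpow_lt_top_of_nonneg (by norm_num) hκ.ne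
  refine ⟨(sobolevConst d s ^ (1 / 2 : ℝ)).toNNReal, ?_⟩
  rintro f A ⟨F, hF, hA⟩
  have hF1 := integrable_fourier hs (hA.trans_lt ENNReal.coe_lt_top)
  have hb : ∫⁻ η, ‖(𝓕 F : L2 d) η‖ₑ ≤ (sobolevConst d s ^ (1 / 2 : ℝ)) * A := by
    rw [← ENNReal.pow_le_pow_left_iff two_ne_zero]
    refine (lintegral_enorm_fourier_sq_le s F).trans ?_
    rw [mul_pow, ← ENNReal.rpow_natCast (_ ^ (1 / 2 : ℝ)), ← ENNReal.rpow_mul]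
    norm_num
    gcongr
  filter_upwards [hF, coeFn_eq_fourierInv hF1] with x h1 h2
  rw [← h1, h2]
  refine (norm_fourierInv_le _ _).trans ?_
  rw [integral_norm_eq_lintegral_enorm hF1.aestronglyMeasurable]
  refine ENNReal.toReal_le_of_le_ofReal (by positivity) (hb.trans_eq ?_)
  rw [ENNReal.ofReal_mul (by positivity), ENNReal.ofReal_coe_nnreal, ENNReal.ofReal_coe_nnreal,
    ENNReal.coe_toNNReal hroot.ne]

/-- Conjugation acts on the Fourier side by `η ↦ conj (f̂ (-η))`, and the weight is even. -/
theorem HasSobolevBound.conj {d : ℕ} {s : ℝ} (hs : (d : ℝ) / 2 < s) {f : Space d → ℂ} {A : ℝ≥0}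
    (hf : HasSobolevBound s f A) : HasSobolevBound s (fun x => (starRingEnd ℂ) (f x)) A := by
  have hs0 : 0 ≤ s := le_trans (by positivity) hs.le
  obtain ⟨F, hF, hA⟩ := hf
  have hF1 := integrable_fourier hs (hA.trans_lt ENNReal.coe_lt_top)
  obtain ⟨h, hh, hhn⟩ := exists_L2_eq_fourierInv (d := d)
    (H := fun η => (starRingEnd ℂ) ((𝓕 F : L2 d) (-η))) (s := s) hs0
    (A := A) ENNReal.coe_lt_top
    ((Complex.conjCLE : ℂ →L[ℝ] ℂ).integrable_comp hF1.comp_neg) (by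
      have e := (Measure.measurePreserving_neg (volume : Measure (Space d))).lintegral_comp
        (f := fun η => sobolevWeight s η * ‖(𝓕 F : L2 d) η‖ₑ ^ 2)
        ((measurable_sobolevWeight s).mul ((L2.measurable_enorm _).pow_const 2))
      refine le_trans (le_of_eq ?_) (pow_le_pow_left' hA 2)
      rw [sobolevNorm_sq, ← e]
      refine lintegral_congr fun η => ?_
      simp [sobolevWeight])
  refine ⟨h, ?_, hhn⟩
  filter_upwards [hh, hF, coeFn_eq_fourierInv hF1] with x h1 h2 h3
  rw [h1, fourierInv_star, ← h3, h2]

theorem HasSobolevBound.zero {d : ℕ} {s : ℝ} (A : ℝ≥0) :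
    HasSobolevBound s (fun _ : Space d => (0 : ℂ)) A :=
  ⟨0, Lp.coeFn_zero _ _ _, by simp [sobolevNorm_zero]⟩

theorem exists_hasSobolevBound_pow_mul {d : ℕ} {s : ℝ} (hs : (d : ℝ) / 2 < s) (σ : ℕ) (A : ℝ≥0) :
    ∃ K : ℝ≥0, ∀ (a X : Space d → ℂ), HasSobolevBound s a A → HasSobolevBound s X A →
      HasSobolevBound s (fun x => a x ^ σ * X x) K := by
  obtain ⟨κ, hκ⟩ := exists_hasSobolevBound_mul hs
  induction σ with
  | zero => exact ⟨A, fun a X _ hX => by simpa using hX⟩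
  | succ n ih =>
    obtain ⟨K, hK⟩ := ih
    refine ⟨κ * A * K, fun a X ha hX => (hκ _ _ _ _ ha (hK a X ha hX)).congr ?_⟩
    exact Filter.Eventually.of_forall fun x => by ring

theorem exists_hasSobolevBound_pow_mul_sub {d : ℕ} {s : ℝ} (hs : (d : ℝ) / 2 < s) (σ : ℕ)
    (A : ℝ≥0) :
    ∃ K : ℝ≥0, ∀ (δ : ℝ≥0) (a b X Y : Space d → ℂ), HasSobolevBound s a A →
      HasSobolevBound s b A → HasSobolevBound s X A → HasSobolevBound s Y A →
      HasSobolevBound s (fun x => a x - b x) δ → HasSobolevBound s (fun x => X x - Y x) δ →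
      HasSobolevBound s (fun x => a x ^ σ * X x - b x ^ σ * Y x) (K * δ) := by
  obtain ⟨κ, hκ⟩ := exists_hasSobolevBound_mul hs
  induction σ with
  | zero => exact ⟨1, fun δ a b X Y _ _ _ _ _ h => by simpa using h⟩
  | succ n ih =>
    obtain ⟨K, hK⟩ := ih
    obtain ⟨K', hK'⟩ := exists_hasSobolevBound_pow_mul hs n A
    refine ⟨κ * A * K + κ * K', fun δ a b X Y ha hb hX hY hab hXY => ?_⟩
    have h1 := hκ _ _ _ _ ha (hK δ a b X Y ha hb hX hY hab hXY)
    have h2 := hκ _ _ _ _ hab (hK' b Y hb hY)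
    -- Telescoping: `a^{n+1} X - b^{n+1} Y = a (a^n X - b^n Y) + (a - b) b^n Y`.
    refine ((h1.add h2).congr (Filter.Eventually.of_forall fun x => ?_)).mono (le_of_eq ?_)
    · ring
    · ring

theorem exists_hasSobolevBound_norm_sq {d : ℕ} {s : ℝ} (hs : (d : ℝ) / 2 < s) :
    ∃ K : ℝ≥0, ∀ (v w : Space d → ℂ) (A δ : ℝ≥0), HasSobolevBound s v A → HasSobolevBound s w A →
      HasSobolevBound s (fun x => v x - w x) δ →
      HasSobolevBound s (fun x => ((‖v x‖ ^ 2 : ℝ) : ℂ)) (K * A * A) ∧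
      HasSobolevBound s (fun x => ((‖v x‖ ^ 2 : ℝ) : ℂ) - ((‖w x‖ ^ 2 : ℝ) : ℂ))
        (2 * K * A * δ) := by
  obtain ⟨κ, hκ⟩ := exists_hasSobolevBound_mul hs
  refine ⟨κ, fun v w A δ hv hw hvw => ⟨(hκ _ _ _ _ hv (hv.conj hs)).congr ?_, ?_⟩⟩
  · refine Filter.Eventually.of_forall fun x => ?_
    simp only [Complex.mul_conj, Complex.normSq_eq_norm_sq]
  -- `|v|² - |w|² = (v - w) v̄ + w (v̄ - w̄)`.
  · have h1 := hκ _ _ _ _ hvw (hv.conj hs)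
    have h2 := hκ _ _ _ _ hw (hvw.conj hs)
    refine ((h1.add h2).congr (Filter.Eventually.of_forall fun x => ?_)).mono (le_of_eq ?_)
    · simp only [← Complex.normSq_eq_norm_sq, ← Complex.mul_conj, map_sub]
      ring
    · ring

/-! ### Consistency of the two saturations -/

/-- The saturations `g h` approximate the identity to order `h^γ` on bounded subsets of `H^s`. -/
def IsConsistentSaturation (d : ℕ) (s γ : ℝ) (g : ℝ → ℝ → ℝ) : Prop :=
  ∀ A : ℝ≥0, ∃ B : ℝ≥0, ∃ h₁ ∈ Ioc (0 : ℝ) 1, ∀ h ∈ Ioc 0 h₁, ∀ v : Space d → ℂ,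
    HasSobolevBound s v A →
      HasSobolevBound s (fun x => ((g h (‖v x‖ ^ 2) : ℝ) : ℂ) - ((‖v x‖ ^ 2 : ℝ) : ℂ))
        (B * (h ^ γ).toNNReal)

/-- By the Sobolev embedding `|v|² ≤ (KA)²` almost everywhere, so for small `h` only the range where
`f` is the identity is visited and the error is exactly zero. Hence `B = 0`, and any exponent `γ` is
allowed. -/
theorem isConsistentSaturation_profile {d : ℕ} {s : ℝ} (hs : (d : ℝ) / 2 < s) (γ : ℝ) {f : ℝ → ℝ}
    (hf : IsSaturationProfile f) : IsConsistentSaturation d s γ (profileSaturation f) := by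
  intro A
  obtain ⟨K, hK⟩ := exists_norm_le_of_hasSobolevBound hs
  refine ⟨0, 1 / ((K * A) ^ 2 + 1), ⟨by positivity, ?_⟩, fun h hh v hv => ?_⟩
  · rw [div_le_one (by positivity)]
    nlinarith [sq_nonneg ((K : ℝ) * A)]
  · refine (HasSobolevBound.zero _).congr ?_
    filter_upwards [hK v A hv] with x hx
    have h0 : 0 < h := hh.1
    have h1 : h * ((K * A) ^ 2 + 1) ≤ 1 := by
      have := hh.2
      rwa [le_div_iff₀ (by positivity)] at this
    have h2 : ‖v x‖ ^ 2 ≤ (K * A) ^ 2 := by gcongr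
    rw [profileSaturation, hf.eq_self _ ⟨by positivity, by nlinarith⟩]
    rw [one_div, inv_mul_cancel_left₀ h0.ne', sub_self]

theorem rationalSaturation_sub {h y : ℝ} (hy : 1 + h * y ≠ 0) :
    rationalSaturation h y - y = -h * (y * rationalSaturation h y) := by
  have : rationalSaturation h y * (1 + h * y) = y := div_mul_cancel₀ _ hy
  linear_combination this

/-- The function `q = r/(1+hr)` is the fixed point of `p ↦ r - h r p`. For small `h` this map
preserves the ball of radius `2R` of `H^s` and contracts pointwise by `1/2`. Its iterates converge
to `q` in `L²`, and lower semicontinuity transfers their `H^s` bound. -/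
theorem hasSobolevBound_rational {d : ℕ} {s : ℝ} {κ K : ℝ≥0}
    (hκ : ∀ (f g : Space d → ℂ) (A B : ℝ≥0), HasSobolevBound s f A →
      HasSobolevBound s g B → HasSobolevBound s (fun x => f x * g x) (κ * A * B))
    (hK : ∀ (f : Space d → ℂ) (A : ℝ≥0), HasSobolevBound s f A → ∀ᵐ x, ‖f x‖ ≤ K * A)
    {r : Space d → ℝ} (hr0 : ∀ x, 0 ≤ r x) {R : ℝ≥0} (hr : HasSobolevBound s (fun x => (r x : ℂ)) R)
    {h : ℝ≥0} (h1 : h * κ * R ≤ 1 / 2) (h2 : h * K * R ≤ 1 / 2) :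
    HasSobolevBound s (fun x => ((rationalSaturation h (r x) : ℝ) : ℂ)) (2 * R) := by
  obtain ⟨ρ, hρ, hρR⟩ := id hr
  set q : Space d → ℂ := fun x => ((rationalSaturation h (r x) : ℝ) : ℂ) with hq
  -- `0 ≤ q ≤ r`. Measurability goes through the real part of the `L²` representative, since `r`
  -- itself need not be measurable.
  have hqm : MemLp q 2 volume := by
    refine (Lp.memLp ρ).of_le ?_ ?_
    · have hm : Measurable fun x => ((rationalSaturation h (ρ x).re : ℝ) : ℂ) := by
        have := (Lp.stronglyMeasurable ρ).measurable
        unfold rationalSaturation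
        fun_prop
      refine hm.aestronglyMeasurable.congr ?_
      filter_upwards [hρ] with x hx
      rw [hq, hx, Complex.ofReal_re]
    · filter_upwards [hρ] with x hx
      rw [hx, hq, Complex.norm_real, Complex.norm_real, Real.norm_eq_abs, Real.norm_eq_abs,
        rationalSaturation, abs_of_nonneg (hr0 x),
        abs_of_nonneg (div_nonneg (hr0 x) (by have := hr0 x; positivity))]
      have := mul_nonneg h.coe_nonneg (hr0 x)
      exact div_le_self (hr0 x) (by linarith)
  let Q : ℕ → Space d → ℂ := fun n => Nat.rec (fun _ => 0)
    (fun _ p x => (r x : ℂ) - (h : ℂ) * ((r x : ℂ) * p x)) n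
  have hQs : ∀ n x, Q (n + 1) x = (r x : ℂ) - (h : ℂ) * ((r x : ℂ) * Q n x) := fun n x => rfl
  have hQ : ∀ n, HasSobolevBound s (Q n) (2 * R) := by
    intro n
    induction n with
    | zero => exact HasSobolevBound.zero _
    | succ n ih =>
      refine (hr.sub ((hκ _ _ _ _ hr ih).const_mul (h : ℂ))).mono ?_
      have hn : ‖(h : ℂ)‖₊ = h := by ext; simp
      rw [hn]
      refine le_trans (add_le_add_right (?_ : _ ≤ R) _) (two_mul R).ge
      calc h * (κ * R * (2 * R)) = (h * κ * R) * (2 * R) := by ring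
        _ ≤ (1 / 2) * (2 * R) := by gcongr
        _ = R := by rw [← mul_assoc]; norm_num
  choose q' hq' hqn using hQ
  have hle : ∀ᵐ x, ∀ n, ‖Q n x - q x‖ ≤ (1 / 2) ^ n * ‖q x‖ := by
    filter_upwards [hK _ _ hr] with x hx n
    have hrx : ‖(h : ℂ) * (r x : ℂ)‖ ≤ 1 / 2 := by
      rw [norm_mul]
      have hn : ‖(h : ℂ)‖ = h := by simp
      rw [hn]
      have h2' : (h : ℝ) * K * R ≤ 1 / 2 := by exact_mod_cast h2
      calc (h : ℝ) * ‖(r x : ℂ)‖ ≤ h * (K * R) := by gcongr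
        _ ≤ 1 / 2 := by linarith
    have hqx : q x = (r x : ℂ) - (h : ℂ) * (r x : ℂ) * q x := by
      have hne : (1 + (h : ℝ) * r x) ≠ 0 := by
        have := mul_nonneg h.coe_nonneg (hr0 x)
        positivity
      have : rationalSaturation h (r x) = r x - h * r x * rationalSaturation h (r x) := by
        linear_combination rationalSaturation_sub hne
      simp only [hq]
      exact_mod_cast congrArg (fun t : ℝ => (t : ℂ)) this
    induction n with
    | zero => simp [Q]
    | succ n ih =>
      have e : Q (n + 1) x - q x = -((h : ℂ) * (r x : ℂ)) * (Q n x - q x) := by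
        conv_lhs => rw [hqx]
        rw [hQs]
        ring
      rw [e, norm_mul, norm_neg, pow_succ', mul_assoc]
      gcongr
  refine ⟨hqm.toLp q, hqm.coeFn_toLp, sobolevNorm_le_of_tendsto (f := q') ?_ hqn⟩
  rw [tendsto_iff_norm_sub_tendsto_zero]
  refine squeeze_zero (fun _ => norm_nonneg _) (g := fun n => (1 / 2 : ℝ) ^ n * ‖hqm.toLp q‖)
    (fun n => Lp.norm_le_mul_norm_of_ae_le_mul ?_) ?_
  · filter_upwards [hle, hq' n, hqm.coeFn_toLp, Lp.coeFn_sub (q' n) (hqm.toLp q)] with x e1 e2 e3 e4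
    rw [e4, Pi.sub_apply, e2, e3]
    exact e1 n
  · simpa using (tendsto_pow_atTop_nhds_zero_of_lt_one (by norm_num : (0 : ℝ) ≤ 1 / 2)
      (by norm_num)).mul_const ‖hqm.toLp q‖

theorem isConsistentSaturation_rational {d : ℕ} {s : ℝ} (hs : (d : ℝ) / 2 < s) {γ : ℝ}
    (hγ : γ ≤ 1) : IsConsistentSaturation d s γ rationalSaturation := by
  intro A
  obtain ⟨κ, hκ⟩ := exists_hasSobolevBound_mul hs
  obtain ⟨K, hK⟩ := exists_norm_le_of_hasSobolevBound hs
  obtain ⟨k, hk⟩ := exists_hasSobolevBound_norm_sq hs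
  set R : ℝ≥0 := k * A * A with hR
  -- The error is `-h r q` with `r` of norm at most `R` and `q` at most `2R`. The threshold gives
  -- both smallness conditions of `hasSobolevBound_rational`, and its `+ 1` keeps it at most `1`.
  refine ⟨κ * R * (2 * R), 1 / (2 * (κ * R + K * R) + 1), ⟨by positivity, ?_⟩, fun h hh v hv => ?_⟩
  · rw [div_le_one (by positivity)]
    have : (0 : ℝ) ≤ κ * R + K * R := by positivity
    linarith
  · have hr := (hk v v A (A + A) hv hv (hv.sub hv)).1
    lift h to ℝ≥0 using hh.1.le
    have hh1 : (h : ℝ) * (2 * (κ * R + K * R) + 1) ≤ 1 := by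
      have := hh.2
      rwa [le_div_iff₀ (by positivity)] at this
    have e0 : (0 : ℝ) ≤ h * (κ * R) := by positivity
    have e0' : (0 : ℝ) ≤ h * (K * R) := by positivity
    have e1 : h * κ * R ≤ 1 / 2 := by
      rw [← NNReal.coe_le_coe]; push_cast; nlinarith [h.coe_nonneg]
    have e2 : h * K * R ≤ 1 / 2 := by
      rw [← NNReal.coe_le_coe]; push_cast; nlinarith [h.coe_nonneg]
    have hq := hasSobolevBound_rational hκ hK (r := fun x => ‖v x‖ ^ 2) (fun x => by positivity)
      hr e1 e2
    refine (((hκ _ _ _ _ hr hq).const_mul (-(h : ℂ))).congr ?_).mono ?_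
    · refine Filter.Eventually.of_forall fun x => ?_
      have hne : (1 + (h : ℝ) * ‖v x‖ ^ 2) ≠ 0 := by positivity
      have : -(h : ℝ) * (‖v x‖ ^ 2 * rationalSaturation h (‖v x‖ ^ 2)) =
          rationalSaturation h (‖v x‖ ^ 2) - ‖v x‖ ^ 2 := (rationalSaturation_sub hne).symm
      dsimp only
      exact_mod_cast congrArg (fun t : ℝ => (t : ℂ)) this
    · have hn : ‖-(h : ℂ)‖₊ = h := by ext; simp
      rw [hn, mul_comm h]
      gcongr
      refine NNReal.le_toNNReal_of_coe_le ?_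
      have hle1 : (h : ℝ) ≤ 1 := by
        have : (0 : ℝ) ≤ h * (2 * (κ * R + K * R)) := by positivity
        linarith
      calc (h : ℝ) = (h : ℝ) ^ (1 : ℝ) := (Real.rpow_one _).symm
        _ ≤ (h : ℝ) ^ γ := Real.rpow_le_rpow_of_exponent_ge hh.1 hle1 hγ

/-! ### Global Lipschitz bounds at fixed `h` -/

/-- The difference of the coefficients is always multiplied by the value of smaller modulus. This is
why the second hypothesis carries the factor `a` with `a ≤ b`. -/
theorem exists_lipschitzWith_nonlinearity {g : ℝ → ℝ} {M M' : ℝ} (hM : ∀ y, 0 ≤ y → |g y| ≤ M)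
    (hM' : ∀ a b, 0 ≤ a → a ≤ b → a * |g (a ^ 2) - g (b ^ 2)| ≤ M' * (b - a)) (σ : ℕ) :
    ∃ L : ℝ≥0, LipschitzWith L fun z : ℂ => (((g (‖z‖ ^ 2)) ^ σ : ℝ) : ℂ) * z := by
  have hM0 : 0 ≤ M := (abs_nonneg _).trans (hM 0 le_rfl)
  have hM'0 : 0 ≤ M' := by have := hM' 0 1 le_rfl zero_le_one; simpa using this
  set L : ℝ := σ * M ^ (σ - 1) * M' + M ^ σ with hL
  have hL0 : 0 ≤ L := by positivity
  have key : ∀ z w : ℂ, ‖z‖ ≤ ‖w‖ → ‖(((g (‖z‖ ^ 2)) ^ σ : ℝ) : ℂ) * z -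
      (((g (‖w‖ ^ 2)) ^ σ : ℝ) : ℂ) * w‖ ≤ L * ‖z - w‖ := by
    intro z w hzw
    set p := g (‖z‖ ^ 2) with hp
    set q := g (‖w‖ ^ 2) with hq
    have hpM : |p| ≤ M := hM _ (by positivity)
    have hqM : |q| ≤ M := hM _ (by positivity)
    have e : ((p ^ σ : ℝ) : ℂ) * z - ((q ^ σ : ℝ) : ℂ) * w =
        ((p ^ σ - q ^ σ : ℝ) : ℂ) * z + ((q ^ σ : ℝ) : ℂ) * (z - w) := by push_cast; ring
    have hnn : ‖w‖ - ‖z‖ ≤ ‖z - w‖ := by rw [norm_sub_rev]; exact norm_sub_norm_le _ _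
    rw [e]
    refine (norm_add_le _ _).trans ?_
    rw [norm_mul, norm_mul, Complex.norm_real, Complex.norm_real, Real.norm_eq_abs,
      Real.norm_eq_abs, abs_pow q, hL, add_mul]
    refine add_le_add ?_ (by gcongr)
    have h1 : |p ^ σ - q ^ σ| ≤ |p - q| * σ * M ^ (σ - 1) := by
      refine (abs_pow_sub_pow_le ..).trans ?_
      gcongr
      exact max_le hpM hqM
    calc |p ^ σ - q ^ σ| * ‖z‖ ≤ |p - q| * σ * M ^ (σ - 1) * ‖z‖ := by gcongr
      _ = σ * M ^ (σ - 1) * (‖z‖ * |p - q|) := by ring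
      _ ≤ σ * M ^ (σ - 1) * (M' * (‖w‖ - ‖z‖)) :=
        mul_le_mul_of_nonneg_left (hM' _ _ (norm_nonneg _) hzw) (by positivity)
      _ ≤ σ * M ^ (σ - 1) * (M' * ‖z - w‖) := by gcongr
      _ = _ := by ring
  refine ⟨L.toNNReal, LipschitzWith.of_dist_le_mul fun z w => ?_⟩
  rw [dist_eq_norm, dist_eq_norm, Real.coe_toNNReal _ hL0]
  rcases le_total ‖z‖ ‖w‖ with h | h
  · exact key z w h
  · rw [norm_sub_rev, norm_sub_rev z]; exact key w z h

theorem exists_lipschitzWith_rational {h : ℝ} (h0 : 0 < h) (σ : ℕ) :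
    ∃ L : ℝ≥0, LipschitzWith L
      fun z : ℂ => (((rationalSaturation h (‖z‖ ^ 2)) ^ σ : ℝ) : ℂ) * z := by
  refine exists_lipschitzWith_nonlinearity (M := 1 / h) (M' := 2 / h) (fun y hy => ?_)
    (fun a b ha hab => ?_) σ
  · have : 0 < 1 + h * y := by positivity
    rw [rationalSaturation, abs_of_nonneg (by positivity), div_le_div_iff₀ this h0]
    nlinarith
  · have hb : 0 ≤ b := ha.trans hab
    have ha' : 0 < 1 + h * a ^ 2 := by positivity
    have hb' : 0 < 1 + h * b ^ 2 := by positivity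
    have e : rationalSaturation h (a ^ 2) - rationalSaturation h (b ^ 2) =
        -((b - a) * (a + b) / ((1 + h * a ^ 2) * (1 + h * b ^ 2))) := by
      unfold rationalSaturation
      field_simp
      ring
    have hba : 0 ≤ b - a := by linarith
    rw [e, abs_neg, abs_of_nonneg (by positivity)]
    -- The numerator is at most `2 b²`, while the denominator is at least `h b²`.
    have h1 : a * (a + b) / ((1 + h * a ^ 2) * (1 + h * b ^ 2)) ≤ 2 / h := by
      rw [div_le_div_iff₀ (by positivity) h0]
      have : 0 ≤ h * a ^ 2 := by positivity
      have h3 : a * (a + b) ≤ 2 * b ^ 2 := by nlinarith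
      nlinarith [mul_nonneg this (by positivity : 0 ≤ h * b ^ 2)]
    calc _ = (a * (a + b) / ((1 + h * a ^ 2) * (1 + h * b ^ 2))) * (b - a) := by ring
      _ ≤ 2 / h * (b - a) := by gcongr

theorem exists_lipschitzWith_profile {f : ℝ → ℝ} (hf : IsSaturationProfile f) {h : ℝ}
    (h0 : 0 < h) (σ : ℕ) :
    ∃ L : ℝ≥0, LipschitzWith L
      fun z : ℂ => (((profileSaturation f h (‖z‖ ^ 2)) ^ σ : ℝ) : ℂ) * z := by
  have hf1 : ContDiff ℝ 1 f := hf.smooth.of_le (by exact_mod_cast le_top)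
  obtain ⟨K, hK⟩ := hf1.locallyLipschitz.locallyLipschitzOn (s := Icc (0 : ℝ) 2) |>.exists_lipschitzOnWith_of_compact isCompact_Icc
  -- On `[0, ∞)` the profile factors through truncation at `2`, so its Lipschitz constant on the
  -- compact `[0, 2]` suffices.
  have hmin : ∀ y, 0 ≤ y → f y = f (min y 2) := by
    intro y hy
    rcases le_total y 2 with h2 | h2
    · rw [min_eq_left h2]
    · rw [min_eq_right h2, hf.eq_two y h2, hf.eq_two 2 le_rfl]
  have hlip : ∀ x y, 0 ≤ x → x ≤ y → |f x - f y| ≤ K * (min y 2 - min x 2) := by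
    intro x y hx hxy
    have hm : min x 2 ≤ min y 2 := min_le_min_right _ hxy
    rw [hmin x hx, hmin y (hx.trans hxy)]
    have := hK.dist_le_mul (min x 2) ⟨le_min hx (by norm_num), min_le_right _ _⟩ (min y 2)
      ⟨le_min (hx.trans hxy) (by norm_num), min_le_right _ _⟩
    rwa [Real.dist_eq, Real.dist_eq, abs_sub_comm (min x 2), abs_of_nonneg (sub_nonneg.2 hm)] at this
  refine exists_lipschitzWith_nonlinearity (M := 1 / h * (2 * K)) (M' := 1 / h * (4 * K))
    (fun y hy => ?_) (fun a b ha hab => ?_) σ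
  · rw [profileSaturation, abs_mul, abs_of_nonneg (by positivity : 0 ≤ 1 / h)]
    gcongr
    have h1 := hlip 0 (h * y) le_rfl (by positivity)
    rw [hf.eq_self 0 (by simp), zero_sub, abs_neg] at h1
    have h2 : min (h * y) 2 - min 0 2 ≤ 2 := by
      have := min_le_right (h * y) 2
      simp only [min_eq_left (by norm_num : (0 : ℝ) ≤ 2)]
      linarith
    calc _ ≤ K * (min (h * y) 2 - min 0 2) := h1
      _ ≤ K * 2 := by gcongr
      _ = 2 * K := by ring
  · have hb : 0 ≤ b := ha.trans hab
    rw [profileSaturation, profileSaturation, ← mul_sub, abs_mul,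
      abs_of_nonneg (by positivity : 0 ≤ 1 / h)]
    have h1 := hlip (h * a ^ 2) (h * b ^ 2) (by positivity) (by gcongr)
    have h2 : a * (min (h * b ^ 2) 2 - min (h * a ^ 2) 2) ≤ 4 * (b - a) := by
      have hab0 : 0 ≤ b - a := by linarith
      rcases le_total 2 (h * a ^ 2) with hA | hA
      · have hB : 2 ≤ h * b ^ 2 := hA.trans (by gcongr)
        rw [min_eq_right hA, min_eq_right hB]
        simpa using hab0
      · rw [min_eq_left hA]
        rcases le_total (h * b ^ 2) 2 with hB | hB
        · rw [min_eq_left hB]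
          have e1 : a * (a + b) ≤ 2 * b ^ 2 := by nlinarith
          have e2 : h * (a * (a + b)) ≤ 4 := by nlinarith
          calc a * (h * b ^ 2 - h * a ^ 2) = h * (a * (a + b)) * (b - a) := by ring
            _ ≤ 4 * (b - a) := by gcongr
        · rw [min_eq_right hB]
          -- The amplitude at which saturation sets in: `a ≤ c ≤ b`, and only the part of the
          -- increment from `a` to `c` counts.
          set c := √(2 / h) with hc
          have hc2 : h * c ^ 2 = 2 := by
            rw [hc, Real.sq_sqrt (by positivity)]; field_simp
          have hc0 : 0 ≤ c := Real.sqrt_nonneg _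
          have hac : a ≤ c := by
            refine abs_le_of_sq_le_sq' ?_ hc0 |>.2
            nlinarith
          have hcb : c ≤ b := by
            refine abs_le_of_sq_le_sq' ?_ hb |>.2
            nlinarith
          have e1 : a * (a + c) ≤ 2 * c ^ 2 := by nlinarith
          have e2 : h * (a * (a + c)) ≤ 4 := by nlinarith
          have hac0 : 0 ≤ c - a := by linarith
          calc a * (2 - h * a ^ 2) = h * (a * (a + c)) * (c - a) := by rw [← hc2]; ring
            _ ≤ 4 * (c - a) := by gcongr
            _ ≤ 4 * (b - a) := by gcongr
    calc a * (1 / h * |f (h * a ^ 2) - f (h * b ^ 2)|)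
        ≤ a * (1 / h * (K * (min (h * b ^ 2) 2 - min (h * a ^ 2) 2))) := by gcongr
      _ = 1 / h * K * (a * (min (h * b ^ 2) 2 - min (h * a ^ 2) 2)) := by ring
      _ ≤ 1 / h * K * (4 * (b - a)) := by gcongr
      _ = _ := by ring

/-! ### The unitary group -/

section propagator

variable {d : ℕ} {P : Space d → ℝ}

theorem measurable_propagatorSymbol (hP : Measurable P) (t : ℝ) :
    Measurable fun ξ => Complex.exp (Complex.I * (t * P ξ : ℝ)) := by
  fun_prop

theorem norm_propagatorSymbol (P : Space d → ℝ) (t : ℝ) (ξ : Space d) :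
    ‖Complex.exp (Complex.I * (t * P ξ : ℝ))‖ = 1 := by
  rw [mul_comm]; exact Complex.norm_exp_ofReal_mul_I _

theorem coeFn_fourier_propagator (hP : Measurable P) (t : ℝ) (f : L2 d) :
    ((𝓕 (propagator P t f) : L2 d) : Space d → ℂ) =ᵐ[volume]
      fun η => Complex.exp (Complex.I * (t * P ((2 * Real.pi) • η) : ℝ)) * (𝓕 f : L2 d) η :=
  coeFn_fourier_fourierMul (measurable_propagatorSymbol hP t)
    (fun ξ => (norm_propagatorSymbol P t ξ).le) f

theorem propagator_sub (hP : Measurable P) (t : ℝ) (f g : L2 d) :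
    propagator P t (f - g) = propagator P t f - propagator P t g :=
  map_sub (fourierMulCLM _ (measurable_propagatorSymbol hP t) 1
    (fun ξ => (norm_propagatorSymbol P t ξ).le)) f g

theorem norm_propagator (hP : Measurable P) (t : ℝ) (f : L2 d) : ‖propagator P t f‖ = ‖f‖ := by
  rw [← Lp.norm_fourier_eq, ← Lp.norm_fourier_eq f, Lp.norm_def, Lp.norm_def]
  congr 1
  refine eLpNorm_congr_norm_ae ?_
  filter_upwards [coeFn_fourier_propagator hP t f] with η h
  rw [h, norm_mul, norm_propagatorSymbol, one_mul]

theorem sobolevNorm_propagator (hP : Measurable P) (s t : ℝ) (f : L2 d) :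
    sobolevNorm s (propagator P t f) = sobolevNorm s f := by
  unfold sobolevNorm
  congr 1
  refine lintegral_congr_ae ?_
  filter_upwards [coeFn_fourier_propagator hP t f] with η h
  rw [h, enorm_mul, ← ofReal_norm (Complex.exp _), norm_propagatorSymbol]
  simp

theorem propagator_add (hP : Measurable P) (t t' : ℝ) (f : L2 d) :
    propagator P (t + t') f = propagator P t (propagator P t' f) := by
  apply L2.ext_fourier
  filter_upwards [coeFn_fourier_propagator hP t (propagator P t' f),
    coeFn_fourier_propagator hP t' f, coeFn_fourier_propagator hP (t + t') f] with η h1 h2 h3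
  rw [h1, h2, h3, ← mul_assoc, ← Complex.exp_add]
  congr 2
  push_cast
  ring

theorem propagator_intervalIntegral (hP : Measurable P) (t a b : ℝ) {G : ℝ → L2 d}
    (hG : IntervalIntegrable G volume a b) :
    propagator P t (∫ τ in a..b, G τ) = ∫ τ in a..b, propagator P t (G τ) :=
  ((fourierMulCLM _ (measurable_propagatorSymbol hP t) 1
    (fun ξ => (norm_propagatorSymbol P t ξ).le)).intervalIntegral_comp_comm hG).symm

/-- Dominated convergence on the Fourier side, with the squared difference dominated by `4 |f̂|²`.
-/
theorem continuous_propagator_left (hP : Measurable P) (f : L2 d) :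
    Continuous fun t => propagator P t f := by
  rw [continuous_iff_continuousAt]
  intro t₀
  rw [ContinuousAt, tendsto_iff_norm_sub_tendsto_zero]
  have hF := L2.measurable_enorm (𝓕 f : L2 d)
  have key : Filter.Tendsto (fun t => ∫⁻ η,
      ‖(Complex.exp (Complex.I * (t * P ((2 * Real.pi) • η) : ℝ)) -
        Complex.exp (Complex.I * (t₀ * P ((2 * Real.pi) • η) : ℝ))) * (𝓕 f : L2 d) η‖ₑ ^ 2)
      (nhds t₀) (nhds (∫⁻ _ : Space d, 0)) := by
    refine tendsto_lintegral_filter_of_dominated_convergence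
      (fun η => (2 * ‖(𝓕 f : L2 d) η‖ₑ) ^ 2) (Filter.Eventually.of_forall fun t => ?_)
      (Filter.Eventually.of_forall fun t => Filter.Eventually.of_forall fun η => ?_) ?_
      (Filter.Eventually.of_forall fun η => ?_)
    · have := (Lp.stronglyMeasurable (𝓕 f : L2 d)).measurable
      fun_prop
    · rw [enorm_mul]
      gcongr
      refine enorm_sub_le.trans_eq ?_
      rw [← ofReal_norm, ← ofReal_norm, norm_propagatorSymbol P t, norm_propagatorSymbol P t₀]
      norm_num
    · have h2 := L2.enorm_eq (𝓕 f : L2 d)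
      have h3 : (∫⁻ η, ‖(𝓕 f : L2 d) η‖ₑ ^ 2) ≠ ⊤ := by
        intro h
        rw [h, ENNReal.top_rpow_of_pos (by norm_num)] at h2
        exact enorm_ne_top h2
      simp only [mul_pow]
      rw [lintegral_const_mul _ (hF.pow_const 2)]
      exact ENNReal.mul_ne_top (by norm_num) h3
    · have hc : Continuous fun t : ℝ => ‖(Complex.exp (Complex.I * (t * P ((2 * Real.pi) • η) : ℝ)) -
        Complex.exp (Complex.I * (t₀ * P ((2 * Real.pi) • η) : ℝ))) * (𝓕 f : L2 d) η‖ₑ ^ 2 := by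
        fun_prop
      simpa using hc.tendsto t₀
  rw [lintegral_zero] at key
  have key2 := (ENNReal.continuous_rpow_const (y := 1 / 2)).tendsto 0 |>.comp key
  rw [ENNReal.zero_rpow_of_pos (by norm_num)] at key2
  have key3 := (ENNReal.tendsto_toReal ENNReal.zero_ne_top).comp key2
  refine key3.congr fun t => ?_
  rw [← Lp.norm_fourier_eq (_ - _), L2.fourier_sub, ← toReal_enorm, L2.enorm_eq]
  simp only [Function.comp]
  congr 2
  refine lintegral_congr_ae ?_
  filter_upwards [coeFn_fourier_propagator hP t f, coeFn_fourier_propagator hP t₀ f,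
    Lp.coeFn_sub (𝓕 (propagator P t f) : L2 d) (𝓕 (propagator P t₀ f))] with η h1 h2 h3
  rw [h3, Pi.sub_apply, h1, h2, sub_mul]

/-- Joint continuity makes the Duhamel integrands strongly measurable and the Picard iterates
continuous in time. -/
theorem continuous_propagator (hP : Measurable P) :
    Continuous fun p : ℝ × L2 d => propagator P p.1 p.2 := by
  refine continuous_prod_of_continuous_lipschitzWith' _ 1 (fun t => ?_)
    (fun f => continuous_propagator_left hP f)
  refine LipschitzWith.of_dist_le_mul fun f g => ?_
  rw [dist_eq_norm, dist_eq_norm, ← propagator_sub hP, norm_propagator hP]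
  simp

theorem norm_exp_I_sub_exp_I_le (a b : ℝ) :
    ‖Complex.exp (Complex.I * (a : ℝ)) - Complex.exp (Complex.I * (b : ℝ))‖ ≤ |a - b| := by
  have e : Complex.exp (Complex.I * (a : ℝ)) - Complex.exp (Complex.I * (b : ℝ)) =
      Complex.exp (b * Complex.I) * (Complex.exp (Complex.I * ((a - b : ℝ) : ℂ)) - 1) := by
    rw [mul_sub, ← Complex.exp_add, mul_one]
    congr 2 <;> push_cast <;> ring
  rw [e, norm_mul, Complex.norm_exp_ofReal_mul_I, one_mul]
  exact Real.norm_exp_I_mul_ofReal_sub_one_le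

/-- Consistency of two propagators whose symbols are close, with a loss of `β` derivatives. -/
theorem sobolevNorm_propagator_sub_le {P' : Space d → ℝ} (hP : Measurable P) (hP' : Measurable P')
    {δ : ℝ≥0} {β : ℝ} (h : ∀ ξ, |P ξ - P' ξ| ≤ δ * (1 + ‖ξ‖ ^ 2) ^ (β / 2)) (s : ℝ) {t : ℝ} {T : ℝ≥0}
    (ht : |t| ≤ T) (f : L2 d) :
    sobolevNorm s (propagator P t f - propagator P' t f) ≤
      (T * δ : ℝ≥0) * sobolevNorm (s + β) f := by
  have hm : Measurable fun η => sobolevWeight (s + β) η * ‖(𝓕 f : L2 d) η‖ₑ ^ 2 :=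
    (measurable_sobolevWeight _).mul ((L2.measurable_enorm _).pow_const 2)
  rw [← ENNReal.pow_le_pow_left_iff two_ne_zero, mul_pow, sobolevNorm_sq, sobolevNorm_sq,
    ← lintegral_const_mul _ hm]
  refine lintegral_mono_ae ?_
  rw [L2.fourier_sub]
  filter_upwards [coeFn_fourier_propagator hP t f, coeFn_fourier_propagator hP' t f,
    Lp.coeFn_sub (𝓕 (propagator P t f) : L2 d) (𝓕 (propagator P' t f))] with η h1 h2 h3
  rw [h3, Pi.sub_apply, h1, h2, ← sub_mul, enorm_mul, mul_pow, sobolevWeight_add]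
  have e : ‖Complex.exp (Complex.I * (t * P ((2 * Real.pi) • η) : ℝ)) -
      Complex.exp (Complex.I * (t * P' ((2 * Real.pi) • η) : ℝ))‖ₑ ^ 2 ≤
      (T * δ : ℝ≥0) ^ 2 * sobolevWeight β η := by
    have e1 : ‖Complex.exp (Complex.I * (t * P ((2 * Real.pi) • η) : ℝ)) -
      Complex.exp (Complex.I * (t * P' ((2 * Real.pi) • η) : ℝ))‖ ≤
        T * (δ * (1 + ‖(2 * Real.pi) • η‖ ^ 2) ^ (β / 2)) := by
      refine (norm_exp_I_sub_exp_I_le _ _).trans ?_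
      rw [← mul_sub, abs_mul]
      gcongr
      exact h _
    have e2 := ENNReal.ofReal_le_ofReal e1
    rw [ofReal_norm, ← mul_assoc, ENNReal.ofReal_mul (by positivity)] at e2
    have e3 := pow_le_pow_left' e2 2
    rw [mul_pow] at e3
    refine e3.trans_eq ?_
    congr 2
    · rw [← NNReal.coe_mul, ENNReal.ofReal_coe_nnreal]
    · rw [sobolevWeight, ← ENNReal.ofReal_pow (by positivity), ← Real.rpow_mul_natCast (by positivity)]
      congr 2
      push_cast; ring
  calc _ ≤ sobolevWeight s η * ((T * δ : ℝ≥0) ^ 2 * sobolevWeight β η * ‖(𝓕 f : L2 d) η‖ₑ ^ 2) := by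
        gcongr
    _ = _ := by ring

end propagator

/-! ### Bounds at every time and the nonlinear estimate -/

theorem sobolevNorm_mono {d : ℕ} {s s' : ℝ} (h : s ≤ s') (f : L2 d) :
    sobolevNorm s f ≤ sobolevNorm s' f := by
  unfold sobolevNorm
  gcongr with η
  nlinarith [sq_nonneg ‖(2 * Real.pi) • η‖]

theorem linftySobolevNorm_le_of_forall {d : ℕ} {T s : ℝ} {u : ℝ → L2 d} {A : ℝ≥0∞}
    (h : ∀ t ∈ Icc 0 T, sobolevNorm s (u t) ≤ A) : linftySobolevNorm T s u ≤ A :=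
  essSup_le_of_ae_le _ ((ae_restrict_iff' measurableSet_Icc).2 (Filter.Eventually.of_forall h))

/-- An `L^∞ H^s` bound on a function continuous with values in `L²` holds at all times. -/
theorem exists_forall_sobolevNorm_le {d : ℕ} {T s : ℝ} (hT : 0 < T) {u : ℝ → L2 d}
    (hu : ContinuousOn u (Icc 0 T)) (h : linftySobolevNorm T s u < ⊤) :
    ∃ A : ℝ≥0, ∀ t ∈ Icc 0 T, sobolevNorm s (u t) ≤ A := by
  refine ⟨(linftySobolevNorm T s u).toNNReal, ?_⟩
  set A := (linftySobolevNorm T s u).toNNReal with hA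
  have hae : ∀ᵐ t ∂(volume.restrict (Icc 0 T)), sobolevNorm s (u t) ≤ A := by
    rw [hA, ENNReal.coe_toNNReal h.ne]
    exact ENNReal.ae_le_essSup _
  intro t ht
  rw [sobolevNorm_le_iff]
  intro N
  -- Taking the maximum with `A` turns the almost-everywhere inequality into an equality of
  -- continuous functions, which then holds everywhere.
  have h1 : ContinuousOn (fun t => max ‖truncBessel d s N (u t)‖ (A : ℝ)) (Icc 0 T) :=
    ContinuousOn.sup ((truncBessel d s N).continuous.comp_continuousOn hu).norm continuousOn_const
  have h2 := Measure.eqOn_Icc_of_ae_eq (μ := volume) hT.ne (g := fun _ => (A : ℝ)) (by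
    filter_upwards [hae] with t ht
    exact max_eq_right (sobolevNorm_le_iff.1 ht N)) h1 continuousOn_const
  exact (le_max_left _ _).trans_eq (h2 ht)

/-- Both saturation and lack of closeness enter linearly: `g_h(|v|²)` is compared with `|v|²` by
consistency, and `|v|²` with `|w|²` by the algebra property. The constant is uniform in `h`. -/
theorem exists_nonlinearity_estimate {d : ℕ} {s : ℝ} (hs : (d : ℝ) / 2 < s) {γ : ℝ} (hγ : 0 < γ)
    {g : ℝ → ℝ → ℝ} (hg : IsConsistentSaturation d s γ g) (σ : ℕ) (A : ℝ≥0) :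
    ∃ K : ℝ≥0, ∃ h₁ ∈ Ioc (0 : ℝ) 1, ∀ h ∈ Ioc 0 h₁, ∀ (v w : Space d → ℂ) (δ : ℝ≥0),
      HasSobolevBound s v A → HasSobolevBound s w A → HasSobolevBound s (fun x => v x - w x) δ →
      HasSobolevBound s (fun x => (((g h (‖v x‖ ^ 2)) ^ σ : ℝ) : ℂ) * v x -
        (((‖w x‖ ^ 2) ^ σ : ℝ) : ℂ) * w x) (K * (δ + (h ^ γ).toNNReal)) := by
  obtain ⟨B, h₁, hh₁, hB⟩ := hg A
  obtain ⟨k, hk⟩ := exists_hasSobolevBound_norm_sq hs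
  obtain ⟨K, hK⟩ := exists_hasSobolevBound_pow_mul_sub hs σ (A + k * A * A + B)
  refine ⟨K * (B + 2 * k * A + 1), h₁, hh₁, fun h hh v w δ hv hw hvw => ?_⟩
  set η := (h ^ γ).toNNReal with hη
  have hη1 : η ≤ 1 := by
    rw [hη, Real.toNNReal_le_one]
    exact Real.rpow_le_one hh.1.le (hh.2.trans hh₁.2) hγ.le
  obtain ⟨hrv, hrvw⟩ := hk v w A δ hv hw hvw
  obtain ⟨hrw, -⟩ := hk w w A (A + A) hw hw (hw.sub hw)
  have hq := hB h hh v hv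
  have hqv : HasSobolevBound s (fun x => ((g h (‖v x‖ ^ 2) : ℝ) : ℂ)) (A + k * A * A + B) := by
    refine ((hq.add hrv).congr (Filter.Eventually.of_forall fun x => by ring)).mono ?_
    calc B * η + k * A * A ≤ B * 1 + k * A * A := by gcongr
      _ ≤ A + (B * 1 + k * A * A) := le_add_self
      _ = _ := by ring
  have hdiff := hK (B * η + 2 * k * A * δ + δ) _ _ v w hqv (hrw.mono ?_) (hv.mono ?_) (hw.mono ?_)
    (((hq.add hrvw).congr (Filter.Eventually.of_forall fun x => by ring)).mono le_self_add)
    (hvw.mono le_add_self)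
  · refine (hdiff.congr (Filter.Eventually.of_forall fun x => ?_)).mono ?_
    · push_cast; ring
    · rw [mul_assoc K]
      gcongr K * ?_
      -- The added terms complete the product `(B + 2kA + 1)(δ + η)`.
      calc B * η + 2 * k * A * δ + δ ≤ B * η + 2 * k * A * δ + δ + (B * δ + 2 * k * A * η + η) :=
            le_self_add
        _ = _ := by ring
  · exact le_trans (le_add_self) le_self_add
  · exact le_trans le_self_add le_self_add
  · exact le_trans le_self_add le_self_add

/-! ### Picard iteration: convergence in `L²`, closeness to `u` in `H^s` -/

/-- The Picard iterates of the Duhamel equation with nonlinearity `F`, started at `u`. -/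
noncomputable def picardIterate {d : ℕ} (P : Space d → ℝ) (ε : ℝ) (F : L2 d → L2 d)
    (u : ℝ → L2 d) : ℕ → ℝ → L2 d
  | 0 => u
  | n + 1 => fun t => propagator P t (u 0) -
      (Complex.I * (ε : ℂ)) • ∫ τ in (0 : ℝ)..t, propagator P (t - τ) (F (picardIterate P ε F u n τ))

section picard

variable {d : ℕ} {P : Space d → ℝ} {ε T : ℝ} {F : L2 d → L2 d} {u : ℝ → L2 d}

theorem intervalIntegrable_propagator (hP : Measurable P) {G : ℝ → L2 d}
    (hG : IntegrableOn G (Icc 0 T) volume) {t : ℝ} (ht : t ∈ Icc 0 T) (a : ℝ) :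
    IntervalIntegrable (fun τ => propagator P (a - τ) (G τ)) volume 0 t := by
  have hG' : IntegrableOn G (Ioc 0 t) volume :=
    hG.mono_set (Ioc_subset_Icc_self.trans (Icc_subset_Icc_right ht.2))
  rw [intervalIntegrable_iff_integrableOn_Ioc_of_le ht.1]
  refine Integrable.mono hG' ?_ (Filter.Eventually.of_forall fun τ => ?_)
  · have h1 : AEStronglyMeasurable (fun τ : ℝ => a - τ) (volume.restrict (Ioc 0 t)) :=
      (continuous_const.sub continuous_id).aestronglyMeasurable
    have h2 : AEStronglyMeasurable (fun τ => (a - τ, G τ)) (volume.restrict (Ioc 0 t)) :=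
      h1.prodMk hG'.aestronglyMeasurable
    have h3 := (continuous_propagator hP).comp_aestronglyMeasurable h2
    exact h3
  · rw [norm_propagator hP]

theorem integrableOn_of_continuousOn {G : ℝ → L2 d} (hG : ContinuousOn G (Icc 0 T)) :
    IntegrableOn G (Icc 0 T) volume :=
  hG.integrableOn_compact isCompact_Icc

theorem continuousOn_picardIterate (hT : 0 ≤ T) (hP : Measurable P) (hF : Continuous F)
    (hu : ContinuousOn u (Icc 0 T)) (n : ℕ) :
    ContinuousOn (picardIterate P ε F u n) (Icc 0 T) := by
  induction n with
  | zero => exact hu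
  | succ n ih =>
    have hG : IntegrableOn (fun τ => F (picardIterate P ε F u n τ)) (Icc 0 T) volume :=
      integrableOn_of_continuousOn (hF.comp_continuousOn ih)
    -- The group law pulls `S(t)` out of the Duhamel integral, leaving a primitive whose integrand
    -- does not depend on `t`.
    have hw : ContinuousOn (fun t => ∫ τ in (0 : ℝ)..t,
        propagator P (0 - τ) (F (picardIterate P ε F u n τ))) (Icc 0 T) := by
      have h := intervalIntegrable_propagator hP hG (right_mem_Icc.2 hT) 0
      have := intervalIntegral.continuousOn_primitive_interval' h left_mem_uIcc
      rwa [uIcc_of_le hT] at this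
    have hS := (continuous_propagator hP).comp_continuousOn
      (continuousOn_id.prodMk hw)
    refine (((continuous_propagator_left hP (u 0)).continuousOn).sub
      (hS.const_smul (Complex.I * (ε : ℂ)))).congr fun t ht => ?_
    simp only [picardIterate, Pi.sub_apply, Pi.smul_apply, Function.comp, id]
    rw [propagator_intervalIntegral hP _ _ _ (intervalIntegrable_propagator hP hG ht 0)]
    congr 2
    refine intervalIntegral.integral_congr fun τ _ => ?_
    rw [← propagator_add hP]
    congr 1
    ring

theorem norm_I_mul (hε : |ε| = 1) : ‖Complex.I * (ε : ℂ)‖ = 1 := by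
  rw [norm_mul, Complex.norm_I, Complex.norm_real, Real.norm_eq_abs, hε, one_mul]

/-- Factorial convergence of the Picard iterates to a solution. -/
theorem norm_picardIterate_sub_le (hT : 0 ≤ T) (hP : Measurable P) (hε : |ε| = 1) {L : ℝ≥0}
    (hF : LipschitzWith L F) (hu : ContinuousOn u (Icc 0 T)) {w : ℝ → L2 d}
    (hw : ContinuousOn w (Icc 0 T))
    (hwu : ∀ t ∈ Icc 0 T, w t = propagator P t (u 0) -
      (Complex.I * (ε : ℂ)) • ∫ τ in (0 : ℝ)..t, propagator P (t - τ) (F (w τ)))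
    {D : ℝ} (hD : ∀ t ∈ Icc 0 T, ‖u t - w t‖ ≤ D) (n : ℕ) :
    ∀ t ∈ Icc 0 T, ‖picardIterate P ε F u n t - w t‖ ≤ D * ((L * t) ^ n / n.factorial) := by
  induction n with
  | zero => intro t ht; simpa [picardIterate] using hD t ht
  | succ n ih =>
    intro t ht
    have hi1 := intervalIntegrable_propagator hP (integrableOn_of_continuousOn
      (hF.continuous.comp_continuousOn
        (continuousOn_picardIterate (ε := ε) hT hP hF.continuous hu n))) ht t
    have hi2 := intervalIntegrable_propagator hP (integrableOn_of_continuousOn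
      (hF.continuous.comp_continuousOn hw)) ht t
    rw [hwu t ht, picardIterate, sub_sub_sub_cancel_left, ← smul_sub, norm_smul, norm_I_mul hε,
      one_mul, norm_sub_rev]
    simp only [Function.comp_def] at hi1 hi2
    rw [← intervalIntegral.integral_sub hi1 hi2]
    have hint : ∫ τ in (0 : ℝ)..t, L * (D * ((L * τ) ^ n / n.factorial)) =
        D * ((L * t) ^ (n + 1) / (n + 1).factorial) := by
      have : ∀ τ : ℝ, L * (D * ((L * τ) ^ n / n.factorial)) =
          (L ^ (n + 1) * D / n.factorial) * τ ^ n := by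
        intro τ; rw [mul_pow]; ring
      simp only [this]
      rw [intervalIntegral.integral_const_mul, integral_pow, Nat.factorial_succ]
      push_cast
      have : (n.factorial : ℝ) ≠ 0 := by positivity
      field_simp
      ring
    rw [← hint]
    refine intervalIntegral.norm_integral_le_of_norm_le ht.1
      (Filter.Eventually.of_forall fun τ hτ => ?_)
      (Continuous.intervalIntegrable (by fun_prop) _ _)
    rw [← propagator_sub hP, norm_propagator hP]
    refine (hF.norm_sub_le _ _).trans ?_
    gcongr
    exact ih τ ⟨hτ.1.le, hτ.2.trans ht.2⟩

theorem tendsto_picardIterate (hT : 0 ≤ T) (hP : Measurable P) (hε : |ε| = 1) {L : ℝ≥0}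
    (hF : LipschitzWith L F) (hu : ContinuousOn u (Icc 0 T)) {w : ℝ → L2 d}
    (hw : ContinuousOn w (Icc 0 T))
    (hwu : ∀ t ∈ Icc 0 T, w t = propagator P t (u 0) -
      (Complex.I * (ε : ℂ)) • ∫ τ in (0 : ℝ)..t, propagator P (t - τ) (F (w τ)))
    {t : ℝ} (ht : t ∈ Icc 0 T) :
    Filter.Tendsto (fun n => picardIterate P ε F u n t) Filter.atTop (nhds (w t)) := by
  obtain ⟨D, hD⟩ := isCompact_Icc.exists_bound_of_continuousOn (hu.sub hw)
  rw [tendsto_iff_norm_sub_tendsto_zero]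
  refine squeeze_zero (fun _ => norm_nonneg _)
    (fun n => norm_picardIterate_sub_le hT hP hε hF hu hw hwu hD n t ht) ?_
  simpa using (FloorSemiring.tendsto_pow_div_factorial_atTop ((L : ℝ) * t)).const_mul D

end picard

theorem intervalIntegral_exp_add_const (K M c η t : ℝ) :
    ∫ τ in (0 : ℝ)..t, (K * (M * η * Real.exp (K * τ)) + c * η) =
      M * η * (Real.exp (K * t) - 1) + c * η * t := by
  have hd : ∀ τ ∈ uIcc 0 t, HasDerivAt (fun τ => M * η * Real.exp (K * τ) + c * η * τ)
      (K * (M * η * Real.exp (K * τ)) + c * η) τ := by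
    intro τ _
    have h1 : HasDerivAt (fun τ => Real.exp (K * τ)) (Real.exp (K * τ) * (K * 1)) τ :=
      ((hasDerivAt_id τ).const_mul K).exp
    have h2 := (h1.const_mul (M * η)).add ((hasDerivAt_id τ).const_mul (c * η))
    convert! h2 using 1
    ring
  rw [intervalIntegral.integral_eq_sub_of_hasDerivAt hd
    (Continuous.intervalIntegrable (by fun_prop) _ _)]
  simp
  ring

/-- The Picard iterates stay close to `u` in `H^s`. -/
theorem sobolevNorm_picardIterate_sub_le {d : ℕ} {s β ε : ℝ} {T : ℝ≥0} {P P' : Space d → ℝ}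
    (hP : Measurable P) (hP' : Measurable P') (hε : |ε| = 1) {u : ℝ → L2 d} {F : L2 d → L2 d}
    (hF : Continuous F) (hu : ContinuousOn u (Icc 0 (T : ℝ))) {N : ℝ → L2 d}
    (hN : IntegrableOn N (Icc 0 (T : ℝ)) volume)
    (hduh : ∀ t ∈ Icc 0 (T : ℝ), u t = propagator P' t (u 0) -
      (Complex.I * (ε : ℂ)) • ∫ τ in (0 : ℝ)..t, propagator P' (t - τ) (N τ))
    {A₀ A₁ C K η : ℝ≥0} (hu0 : sobolevNorm (s + β) (u 0) ≤ A₀)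
    (hNb : ∀ᵐ t ∂(volume.restrict (Icc 0 (T : ℝ))), sobolevNorm (s + β) (N t) ≤ A₁)
    (hPP' : ∀ ξ, |P ξ - P' ξ| ≤ (C * η : ℝ≥0) * (1 + ‖ξ‖ ^ 2) ^ (β / 2))
    (hFN : ∀ᵐ t ∂(volume.restrict (Icc 0 (T : ℝ))), ∀ (v : L2 d) (δ : ℝ≥0), δ ≤ 1 →
      sobolevNorm s (v - u t) ≤ δ → sobolevNorm s (F v - N t) ≤ (K * (δ + η) : ℝ≥0))
    {M : ℝ} (hM : M = T * C * A₀ + (K + T * C * A₁) * T)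
    (hsmall : M * η * Real.exp (K * T) ≤ 1) (n : ℕ) :
    ∀ t ∈ Icc 0 (T : ℝ), sobolevNorm s (picardIterate P ε F u n t - u t) ≤
      ENNReal.ofReal (M * η * Real.exp (K * t)) := by
  have hM0 : 0 ≤ M := by rw [hM]; positivity
  induction n with
  | zero =>
    intro t ht
    simp [picardIterate, sobolevNorm_zero]
  | succ n ih =>
    intro t ht
    have hi1 := intervalIntegrable_propagator hP (integrableOn_of_continuousOn
      (hF.comp_continuousOn
        (continuousOn_picardIterate (ε := ε) T.coe_nonneg hP hF hu n))) ht t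
    have hi2 := intervalIntegrable_propagator hP' hN ht t
    simp only [Function.comp_def] at hi1
    have e : picardIterate P ε F u (n + 1) t - u t =
        (propagator P t (u 0) - propagator P' t (u 0)) -
          (Complex.I * (ε : ℂ)) • ∫ τ in (0 : ℝ)..t,
            (propagator P (t - τ) (F (picardIterate P ε F u n τ)) -
              propagator P' (t - τ) (N τ)) := by
      rw [intervalIntegral.integral_sub hi1 hi2, smul_sub]
      conv_lhs => rw [hduh t ht]
      rw [picardIterate, sub_sub_sub_comm]
    have habs : ∀ τ ∈ Icc 0 t, |t - τ| ≤ (T : ℝ) := by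
      intro τ hτ
      rw [abs_of_nonneg (sub_nonneg.2 hτ.2)]
      linarith [hτ.1, ht.2]
    have hlin : sobolevNorm s (propagator P t (u 0) - propagator P' t (u 0)) ≤
        ENNReal.ofReal (T * C * A₀ * η) := by
      refine (sobolevNorm_propagator_sub_le hP hP' hPP' s
        (by simpa using habs 0 ⟨le_rfl, ht.1⟩) (u 0)).trans ?_
      calc _ ≤ ((T * (C * η) : ℝ≥0) : ℝ≥0∞) * A₀ := by gcongr
        _ = ENNReal.ofReal ((T * C * A₀ * η : ℝ≥0) : ℝ) := by
          rw [ENNReal.ofReal_coe_nnreal, ← ENNReal.coe_mul]; congr 1; ring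
        _ = _ := by push_cast; rfl
    have hint : sobolevNorm s (∫ τ in (0 : ℝ)..t,
            (propagator P (t - τ) (F (picardIterate P ε F u n τ)) -
              propagator P' (t - τ) (N τ))) ≤
        ENNReal.ofReal (∫ τ in (0 : ℝ)..t,
          (K * (M * η * Real.exp (K * τ)) + (K + T * C * A₁) * η)) := by
      refine sobolevNorm_intervalIntegral_le ht.1 (hi1.sub hi2)
        (Continuous.intervalIntegrable (by fun_prop) _ _) ?_ (fun τ _ => by positivity)
      have hsub : Ioc 0 t ⊆ Icc 0 (T : ℝ) := Ioc_subset_Icc_self.trans (Icc_subset_Icc_right ht.2)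
      filter_upwards [ae_restrict_of_ae_restrict_of_subset hsub hNb,
        ae_restrict_of_ae_restrict_of_subset hsub hFN, ae_restrict_mem measurableSet_Ioc]
        with τ hτN hτF hτ
      have hδ := ih τ (hsub hτ)
      have hδ1 : (M * η * Real.exp (K * τ)).toNNReal ≤ 1 := by
        rw [Real.toNNReal_le_one]
        refine le_trans ?_ hsmall
        gcongr
        exact (hsub hτ).2
      have h1 := hτF _ _ hδ1 hδ
      -- The difference of the groups acts only on `N`, which has `s + β` derivatives. The iterate
      -- is known only in `H^s`, and meets a single isometric group.
      have e2 : propagator P (t - τ) (F (picardIterate P ε F u n τ)) - propagator P' (t - τ) (N τ) =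
          propagator P (t - τ) (F (picardIterate P ε F u n τ) - N τ) +
            (propagator P (t - τ) (N τ) - propagator P' (t - τ) (N τ)) := by
        rw [propagator_sub hP]; abel
      rw [e2]
      refine (sobolevNorm_add_le _ _ _).trans ?_
      rw [sobolevNorm_propagator hP]
      refine (add_le_add h1 ((sobolevNorm_propagator_sub_le hP hP' hPP' s
        (habs τ ⟨hτ.1.le, hτ.2⟩) (N τ)).trans (mul_le_mul_right hτN _))).trans_eq ?_
      rw [← ENNReal.coe_mul, ← ENNReal.coe_add, ← ENNReal.ofReal_coe_nnreal]
      congr 1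
      push_cast
      rw [Real.coe_toNNReal _ (by positivity)]
      ring
    rw [e]
    refine (sobolevNorm_sub_le _ _ _).trans ?_
    rw [sobolevNorm_smul, ← ofReal_norm, norm_I_mul hε, ENNReal.ofReal_one, one_mul]
    refine (add_le_add hlin hint).trans ?_
    have hexp : 1 ≤ Real.exp (K * t) := Real.one_le_exp (by have := ht.1; positivity)
    rw [intervalIntegral_exp_add_const, ← ENNReal.ofReal_add (by positivity)
      (add_nonneg (mul_nonneg (by positivity) (by linarith)) (by have := ht.1; positivity))]
    refine ENNReal.ofReal_le_ofReal ?_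
    have h3 : (K + T * C * A₁ : ℝ) * η * t ≤ (K + T * C * A₁) * η * T := by
      gcongr; exact ht.2
    -- `M` is exactly the sum of the source terms, so it cancels the `-Mη` left by integrating the
    -- exponential and the induction closes with the same constant.
    calc _ ≤ T * C * A₀ * η + (M * η * (Real.exp (K * t) - 1) + (K + T * C * A₁) * η * T) := by
          gcongr
      _ = M * η * Real.exp (K * t) := by rw [hM]; ring

/-! ### The error estimate -/

/-- A family of saturations that is consistent to order `h^γ` and Lipschitz for each `h` leads to an
`O(h^γ)` error between the solutions. -/
theorem exists_linftySobolevNorm_sub_le {d : ℕ} {σ : ℕ} {ε T s β γ : ℝ} (hε : |ε| = 1) (hT : 0 < T)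
    (hs : (d : ℝ) / 2 < s) (hγ : 0 < γ) (hβ : 0 ≤ β) {P : ℝ → Space d → ℝ}
    (hPmeas : ∀ h ∈ Ioc (0 : ℝ) 1, Measurable (P h)) {C : ℝ≥0}
    (hP : ∀ h ∈ Ioc (0 : ℝ) 1, ∀ ξ : Space d,
      |P h ξ - laplaceSymbol ξ| ≤ C * h ^ γ * (1 + ‖ξ‖ ^ 2) ^ (β / 2))
    {u : ℝ → L2 d} (hu : IsMildSolution laplaceSymbol ε (fun y => y) σ T u)
    (hureg : linftySobolevNorm T (s + β) u < ⊤) {g : ℝ → ℝ → ℝ}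
    (hg : IsConsistentSaturation d s γ g)
    (hL : ∀ h ∈ Ioc (0 : ℝ) 1, ∃ L : ℝ≥0, LipschitzWith L
      fun z : ℂ => (((g h (‖z‖ ^ 2)) ^ σ : ℝ) : ℂ) * z) :
    ∃ C : ℝ, ∃ h₀ ∈ Ioc (0 : ℝ) 1, ∀ h ∈ Ioc 0 h₀, ∀ uh : ℝ → L2 d,
      IsMildSolution (P h) ε (g h) σ T uh → uh 0 = u 0 →
        linftySobolevNorm T s (fun t => u t - uh t) ≤ ENNReal.ofReal (C * h ^ γ) := by
  have hsβ : (d : ℝ) / 2 < s + β := by linarith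
  obtain ⟨hucont, N, hNeq, hNint, hduh⟩ := hu
  obtain ⟨A₀, hA₀⟩ := exists_forall_sobolevNorm_le hT hucont hureg
  obtain ⟨κ, hκ⟩ := exists_hasSobolevBound_norm_sq hsβ
  obtain ⟨A₁, hA₁⟩ := exists_hasSobolevBound_pow_mul hsβ σ (A₀ + κ * A₀ * A₀)
  -- The `+ 1` leaves room for functions within distance `1` of `u(t)` in `H^s`.
  obtain ⟨K, h₁, hh₁, hK⟩ := exists_nonlinearity_estimate hs hγ hg σ (A₀ + 1)
  lift T to ℝ≥0 using hT.le
  have hNb : ∀ᵐ t ∂(volume.restrict (Icc 0 (T : ℝ))), sobolevNorm (s + β) (N t) ≤ A₁ := by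
    filter_upwards [hNeq, ae_restrict_mem measurableSet_Icc] with t hNt ht
    have hut := HasSobolevBound.of_L2 (hA₀ t ht)
    have hsq := (hκ _ _ A₀ _ hut hut (hut.sub hut)).1
    have h := hA₁ _ _ (hsq.mono le_add_self) (hut.mono le_self_add)
    refine (h.congr (Filter.EventuallyEq.trans (Filter.Eventually.of_forall fun x => ?_)
      hNt.symm)).sobolevNorm_le
    push_cast
    rfl
  set M : ℝ := T * C * A₀ + (K + T * C * A₁) * T with hM
  have hM0 : 0 ≤ M := by positivity
  set E : ℝ := M * Real.exp (K * T) with hE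
  have hE0 : 0 ≤ E := by positivity
  -- Chosen so that `E h^γ ≤ 1` for `h ≤ h₂`, which keeps the iterates within distance `1` of `u`.
  set h₂ : ℝ := (1 / (E + 1)) ^ (1 / γ) with hh₂
  have hh₂0 : 0 < h₂ := by positivity
  refine ⟨E, min h₁ h₂, ⟨lt_min hh₁.1 hh₂0, (min_le_left _ _).trans hh₁.2⟩,
    fun h hh uh huh huh0 => ?_⟩
  have hhh₁ : h ∈ Ioc 0 h₁ := ⟨hh.1, hh.2.trans (min_le_left _ _)⟩
  have hh1 : h ∈ Ioc (0 : ℝ) 1 := ⟨hh.1, hhh₁.2.trans hh₁.2⟩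
  have hpow0 : 0 ≤ h ^ γ := Real.rpow_nonneg hh.1.le _
  have hηcoe : ((h ^ γ).toNNReal : ℝ) = h ^ γ := Real.coe_toNNReal _ hpow0
  have hsmall : M * (h ^ γ).toNNReal * Real.exp (K * T) ≤ 1 := by
    have h3 : h ^ γ ≤ 1 / (E + 1) := by
      calc h ^ γ ≤ h₂ ^ γ := Real.rpow_le_rpow hh.1.le (hh.2.trans (min_le_right _ _)) hγ.le
        _ = 1 / (E + 1) := by
          rw [hh₂, ← Real.rpow_mul (by positivity), one_div_mul_cancel hγ.ne', Real.rpow_one]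
    rw [hηcoe]
    calc M * h ^ γ * Real.exp (K * T) = E * h ^ γ := by rw [hE]; ring
      _ ≤ E * (1 / (E + 1)) := by gcongr
      _ ≤ 1 := by rw [mul_one_div, div_le_one (by positivity)]; linarith
  obtain ⟨L, hL⟩ := hL h hh1
  set F : L2 d → L2 d := hL.compLp (by simp) with hF
  have hFL : LipschitzWith L F := hL.lipschitzWith_compLp (by simp)
  have hFcoe : ∀ v : L2 d, (F v : Space d → ℂ) =ᵐ[volume]
      fun x => (((g h (‖v x‖ ^ 2)) ^ σ : ℝ) : ℂ) * v x := fun v => hL.coeFn_compLp (by simp) v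
  have hFN : ∀ᵐ t ∂(volume.restrict (Icc 0 (T : ℝ))), ∀ (v : L2 d) (δ : ℝ≥0), δ ≤ 1 →
      sobolevNorm s (v - u t) ≤ δ →
        sobolevNorm s (F v - N t) ≤ (K * (δ + (h ^ γ).toNNReal) : ℝ≥0) := by
    filter_upwards [hNeq, ae_restrict_mem measurableSet_Icc] with t hNt ht v δ hδ hv
    have hut := HasSobolevBound.of_L2
      ((sobolevNorm_mono (by linarith : s ≤ s + β) (u t)).trans (hA₀ t ht))
    have hvu := (HasSobolevBound.of_L2 hv).congr (Lp.coeFn_sub v (u t))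
    have hvb : HasSobolevBound s v (A₀ + 1) :=
      ((hut.add hvu).congr (Filter.Eventually.of_forall fun x => by simp)).mono (by gcongr)
    refine ((hK h hhh₁ v (u t) δ hvb (hut.mono le_self_add) hvu).congr ?_).sobolevNorm_le
    filter_upwards [hFcoe v, hNt, Lp.coeFn_sub (F v) (N t)] with x h1 h2 h3
    rw [h3, Pi.sub_apply, h1, h2]
  obtain ⟨huhcont, Nh, hNheq, -, huhduh⟩ := huh
  have huhduh' : ∀ t ∈ Icc 0 (T : ℝ), uh t = propagator (P h) t (u 0) -
      (Complex.I * (ε : ℂ)) • ∫ τ in (0 : ℝ)..t, propagator (P h) (t - τ) (F (uh τ)) := by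
    intro t ht
    rw [huhduh t ht, huh0]
    congr 2
    refine intervalIntegral.integral_congr_ae ?_
    rw [uIoc_of_le ht.1, ← ae_restrict_iff' measurableSet_Ioc]
    have hsub : Ioc 0 t ⊆ Icc 0 (T : ℝ) := Ioc_subset_Icc_self.trans (Icc_subset_Icc_right ht.2)
    filter_upwards [ae_restrict_of_ae_restrict_of_subset hsub hNheq] with τ hτ
    rw [Lp.ext (hτ.trans (hFcoe (uh τ)).symm)]
  have hlap : Measurable (laplaceSymbol : Space d → ℝ) := by
    unfold laplaceSymbol
    fun_prop
  have hiter := sobolevNorm_picardIterate_sub_le (s := s) (β := β) (C := C) (hPmeas h hh1) hlap hε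
    hFL.continuous hucont hNint hduh (hA₀ 0 ⟨le_rfl, T.coe_nonneg⟩) hNb
    (fun ξ => by rw [NNReal.coe_mul, hηcoe]; exact hP h hh1 ξ) hFN hM hsmall
  refine linftySobolevNorm_le_of_forall fun t ht => ?_
  have hlim := tendsto_picardIterate T.coe_nonneg (hPmeas h hh1) hε hFL hucont huhcont huhduh' ht
  rw [← neg_sub, sobolevNorm_neg]
  refine sobolevNorm_le_of_tendsto (A := (E * h ^ γ).toNNReal) (hlim.sub_const (u t)) fun n => ?_
  refine (hiter n t ht).trans (ENNReal.ofReal_le_ofReal ?_)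
  rw [hηcoe]
  calc M * h ^ γ * Real.exp (K * t) ≤ M * h ^ γ * Real.exp (K * T) := by
        gcongr; exact ht.2
    _ = E * h ^ γ := by rw [hE]; ring

theorem mainTheorem5 (d : ℕ) (hd : 1 ≤ d) (σ : ℕ) (ε : ℝ) (hε : ε = 1 ∨ ε = -1)
    (T : ℝ) (hT : 0 < T) (s α β : ℝ) (hs : (d : ℝ) / 2 < s) (hα : 0 < α) (hβ : 0 ≤ β)
    (P : ℝ → Space d → ℝ) (hPmeas : ∀ h ∈ Set.Ioc (0 : ℝ) 1, Measurable (P h))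
    (hP : ∃ C : ℝ, ∀ h ∈ Set.Ioc (0 : ℝ) 1, ∀ ξ : Space d,
      |P h ξ - (-‖ξ‖ ^ 2)| ≤ C * h ^ α * (1 + ‖ξ‖ ^ 2) ^ (β / 2))
    (u : ℝ → L2 d) (hu : IsMildSolution laplaceSymbol ε (fun y => y) σ T u)
    (hureg : linftySobolevNorm T (s + β) u < ⊤) :
    (∀ f : ℝ → ℝ, IsSaturationProfile f →
      ∃ C : ℝ, ∃ h₀ ∈ Set.Ioc (0 : ℝ) 1, ∀ h ∈ Set.Ioc 0 h₀, ∀ uh : ℝ → L2 d,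
        IsMildSolution (P h) ε (profileSaturation f h) σ T uh → uh 0 = u 0 →
          linftySobolevNorm T s (fun t => u t - uh t) ≤ ENNReal.ofReal (C * h ^ α)) ∧
    (∃ C : ℝ, ∃ h₀ ∈ Set.Ioc (0 : ℝ) 1, ∀ h ∈ Set.Ioc 0 h₀, ∀ uh : ℝ → L2 d,
      IsMildSolution (P h) ε (rationalSaturation h) σ T uh → uh 0 = u 0 →
        linftySobolevNorm T s (fun t => u t - uh t) ≤ ENNReal.ofReal (C * h ^ min α 1)) := by
  have hε' : |ε| = 1 := by rcases hε with rfl | rfl <;> simp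
  obtain ⟨C, hC⟩ := hP
  -- Since `h ≤ 1`, the symbol bound may be weakened to any exponent `γ ≤ α`; the second part uses
  -- `γ = min α 1`.
  have hP' : ∀ γ ≤ α, ∀ h ∈ Ioc (0 : ℝ) 1, ∀ ξ : Space d,
      |P h ξ - laplaceSymbol ξ| ≤ C.toNNReal * h ^ γ * (1 + ‖ξ‖ ^ 2) ^ (β / 2) := by
    intro γ hγ h hh ξ
    refine (hC h hh ξ).trans ?_
    have h1 : C ≤ C.toNNReal := Real.le_coe_toNNReal C
    have h2 : h ^ α ≤ h ^ γ := Real.rpow_le_rpow_of_exponent_ge hh.1 hh.2 hγ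
    have h3 : 0 ≤ h ^ α := Real.rpow_nonneg hh.1.le _
    gcongr
  refine ⟨fun f hf => ?_, ?_⟩
  · exact exists_linftySobolevNorm_sub_le hε' hT hs hα hβ hPmeas (hP' α le_rfl) hu hureg
      (isConsistentSaturation_profile hs α hf)
      (fun h hh => exists_lipschitzWith_profile hf hh.1 σ)
  · exact exists_linftySobolevNorm_sub_le hε' hT hs (lt_min hα one_pos) hβ hPmeas
      (hP' _ (min_le_left _ _)) hu hureg (isConsistentSaturation_rational hs (min_le_right _ _))
      (fun h hh => exists_lipschitzWith_rational hh.1 σ)
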